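/- **Theorem (Cubic $\forall$-lazy cut-elimination).** *Types, terms.* Types are $A ::= \alpha \mid A\multimap A \mid A\,\&\,A \mid \forall\alpha.A$. Positive and negative subtypes of $A$: $A$ is a positive subtype of itself; passing to the left of $\multimap$ flips the sign, passing to the right of $\multimap$, to a component of $\&$ or to the body of $\forall$ keeps it. A type is *$\forall$-lazy* if it has no negative subtype of the form $\forall\alpha.B$; it is closed if it has no free type variables. Raw terms are $M ::= x\mid\lambda x.M\mid MM\mid\langle M,M\rangle\mid\pi_i(M)\mid \mathtt{copy}^{V} M\ \mathtt{as}\ x_1,x_2\ \mathtt{in}\ \langle M_1,M_2\rangle$ (binding $x_j$ in $M_j$). A *value* is a closed term free from $\mathtt{copy}$ and projections and normal for $(\lambda x.M)N\to M[N/x]$. *The system $\mathsf{LAM}$.* Judgements are $\Gamma\vdash M:A$, with $\Gamma$ a finite multiset of assumptions $x:B$ with distinct names $x$. The rules are: - $ax$: $x:A\vdash x:A$; - $cut$: from $\Gamma\vdash N:A$ and $\Delta,x:A\vdash M:C$ infer $\Gamma,\Delta\vdash M[N/x]:C$; - $\multimap$R: from $\Gamma,x:A\vdash M:B$ infer $\Gamma\vdash\lambda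 x.M:A\multimap B$; - $\multimap$L: from $\Gamma\vdash N:A$ and $\Delta,x:B\vdash M:C$ infer $\Gamma,y:A\multimap B,\Delta\vdash M[yN/x]:C$, provided that $B$ closed implies $A$ closed; - $\forall$R: from $\Gamma\vdash M:A\langle\gamma/\alpha\rangle$ infer $\Gamma\vdash M:\forall\alpha.A$, where $\gamma$ is free neither in $\Gamma$ nor in $\forall\alpha.A$, provided that $\forall\alpha.A$ closed implies that all types in $\Gamma$ are closed; - $\forall$L: from $\Gamma,x:A\langle B/\alpha\rangle\vdash M:C$ infer $\Gamma,x:\forall\alpha.A\vdash M:C$; - $\&$R$0$: from $\vdash M_1:A_1$ and $\vdash M_2:A_2$ infer $\vdash\langle M_1,M_2\rangle:A_1\& A_2$; - $\&$L$i$ ($i\in\{1,2\}$): from $\Gamma,x_i:A_i\vdash M:C$ infer $\Gamma,y:A_1\& A_2\vdash M[\pi_i(y)/x_i]:C$; - $\&$R$1$: from $x_1:A\vdash M_1:A_1$, $x_2:A\vdash M_2:A_2$ and $\vdash V:A$ infer $x:A\vdash\mathtt{copy}^{V}x\ \mathtt{as}\ x_1,x_2\ \mathtt{in}\ \langle M_1,M_2\rangle:A_1\&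 A_2$, where $V$ is a value and the derivation of $\vdash V:A$ is cut-free with atomic axioms ($x:\alpha\vdash x:\alpha$ with $\alpha$ a type variable). In the last three rules $A,A_1,A_2$ are closed and $\forall$-lazy. The two "provided that" clauses are the *closure conditions*. The size $|\mathcal D|$ is the number of rule instances of $\mathcal D$. A derivation of $x_1:A_1,\dots,x_n:A_n\vdash M:B$ is *$\forall$-lazy* if $A_1\multimap\dots\multimap A_n\multimap B$ is. *Cuts and steps.* Write $(X,Y)$ for a cut whose left and right premises are conclusions of $X$ and $Y$ (with $Y$, if it is a left rule, introducing the cut formula in the cases named below). *Symmetric* cuts: $(\multimap\mathrm R,\multimap\mathrm L)$, $(\&\mathrm R0,\&\mathrm Li)$, $(\forall\mathrm R,\forall\mathrm L)$, $(X,ax)$, $(ax,Y)$; *copy-first* cuts: $(\&\mathrm R1,\&\mathrm Li)$; *critical* cuts: $(X,\&\mathrm R1)$; *commuting* cuts: all others. A critical cut is *ready* if its left premise has empty context and a cut-free derivation. A *$\forall$-lazy cut-elimination step* applies one of the following to a cut anywhere in a derivation tree: the standard reduction of a symmetric cut; the standard permutation of a commuting cut over the last rule of one of its premises, that rule (possibly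 itself a $cut$) not introducing the cut formula; the replacement of a ready cut, with $\mathcal D'$ deriving $\vdash U:A$ on the left and $\mathcal D_1,\mathcal D_2$ the first two premises of $\&$R$1$, by $\&$R$0$ applied to the cuts of $\mathcal D'$ with $\mathcal D_1$ and of $\mathcal D'$ with $\mathcal D_2$. Other critical cuts and copy-first cuts have no step. *Strategy.* A *round* consists of (1) finitely many steps on commuting cuts, after which every remaining commuting cut has a premise that is itself the conclusion of a $cut$; then (2) one step on a symmetric cut if there is one, and otherwise one step on a ready cut. **Claim.** There is a constant $c$ such that, for every $\forall$-lazy derivation $\mathcal D$ of $\Gamma\vdash M:A$ in $\mathsf{LAM}$: 1. every tree reached from $\mathcal D$ by $\forall$-lazy cut-elimination steps is a derivation of $\Gamma\vdash M':A$ for some $M'$, by the rules of $\mathsf{LAM}$ without the closure conditions; 2. some finite sequence of rounds, with at most $c\cdot|\mathcal D|^3$ cut-elimination steps altogether, leads from $\mathcal D$ to a cut-free derivation $\mathcal D^\dagger$ of $\Gamma\vdash M^\dagger:A$ in $\mathsf{LAM}$ (closure conditions included), for some term $M^\dagger$. -/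

import Mathlib

namespace LAM

/-! ### Types -/

/-- Types `A ::= α | A ⊸ A | A & A | ∀α.A`, with de Bruijn indices for type variables. -/
inductive Ty : Type
  | var (n : ℕ)
  | lolli (A B : Ty)
  | amp (A B : Ty)
  | all (A : Ty)

namespace Ty

/-- Lift a renaming of indices under one binder. -/
def upr (ρ : ℕ → ℕ) : ℕ → ℕ
  | 0 => 0
  | n + 1 => ρ n + 1

def rename : (ℕ → ℕ) → Ty → Ty
  | ρ, var n => var (ρ n)
  | ρ, lolli A B => lolli (A.rename ρ) (B.rename ρ)
  | ρ, amp A B => amp (A.rename ρ) (B.rename ρ)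
  | ρ, all A => all (A.rename (upr ρ))

/-- Lift a substitution under one binder. -/
def up (σ : ℕ → Ty) : ℕ → Ty
  | 0 => var 0
  | n + 1 => (σ n).rename Nat.succ

/-- Simultaneous capture-avoiding substitution. -/
def subst : (ℕ → Ty) → Ty → Ty
  | σ, var n => σ n
  | σ, lolli A B => lolli (A.subst σ) (B.subst σ)
  | σ, amp A B => amp (A.subst σ) (B.subst σ)
  | σ, all A => all (A.subst (up σ))

/-- The substitution that replaces index `0` by `B` and lowers the other indices. -/
def single (B : Ty) : ℕ → Ty
  | 0 => B
  | n + 1 => var n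

/-- `A⟨B/α⟩`, where `A` is the body of `∀α.A`. -/
def inst (A B : Ty) : Ty := A.subst (single B)

/-- Free type variables. -/
def fv : Ty → Set ℕ
  | var n => {n}
  | lolli A B => A.fv ∪ B.fv
  | amp A B => A.fv ∪ B.fv
  | all A => {n | n + 1 ∈ A.fv}

def Closed (A : Ty) : Prop := A.fv = ∅

/-- `Subtype p B A`: `B` is a positive (`p = true`) or negative (`p = false`) subtype of `A`. -/
inductive Subtype : Bool → Ty → Ty → Prop
  | refl (A : Ty) : Subtype true A A
  | lolli_left {p : Bool} {A B C : Ty} : Subtype p (lolli B C) A → Subtype (!p) B A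
  | lolli_right {p : Bool} {A B C : Ty} : Subtype p (lolli B C) A → Subtype p C A
  | amp_left {p : Bool} {A B C : Ty} : Subtype p (amp B C) A → Subtype p B A
  | amp_right {p : Bool} {A B C : Ty} : Subtype p (amp B C) A → Subtype p C A
  | all_body {p : Bool} {A B : Ty} : Subtype p (all B) A → Subtype p B A

/-- A type is `∀`-lazy if it has no negative occurrence of `∀`. -/
def ForallLazy (A : Ty) : Prop := ¬ ∃ B, Subtype false (all B) A

end Ty

/-! ### Terms -/

/-- The two components of a pair. -/
inductive Side : Type
  | fst
  | snd

/-- Choose one of two things. -/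
def Side.pick {α : Type} : Side → α → α → α
  | fst, a, _ => a
  | snd, _, b => b

/-- Raw terms with de Bruijn indices; `copy V M P Q` is `copy^V M as x, y in ⟨P, Q⟩`, where
index `0` of `P` (resp. `Q`) is the bound variable `x` (resp. `y`). -/
inductive Term : Type
  | var (n : ℕ)
  | lam (M : Term)
  | app (M N : Term)
  | pair (M N : Term)
  | proj (i : Side) (M : Term)
  | copy (V M P Q : Term)

namespace Term

/-- The label `V` of `copy` is always a closed term: renamings and substitutions do not act
on it. -/
def rename : (ℕ → ℕ) → Term → Term
  | ρ, var n => var (ρ n)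
  | ρ, lam M => lam (M.rename (Ty.upr ρ))
  | ρ, app M N => app (M.rename ρ) (N.rename ρ)
  | ρ, pair M N => pair (M.rename ρ) (N.rename ρ)
  | ρ, proj i M => proj i (M.rename ρ)
  | ρ, copy V M P Q => copy V (M.rename ρ) (P.rename (Ty.upr ρ)) (Q.rename (Ty.upr ρ))

def up (σ : ℕ → Term) : ℕ → Term
  | 0 => var 0
  | n + 1 => (σ n).rename Nat.succ

def subst : (ℕ → Term) → Term → Term
  | σ, var n => σ n
  | σ, lam M => lam (M.subst (up σ))
  | σ, app M N => app (M.subst σ) (N.subst σ)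
  | σ, pair M N => pair (M.subst σ) (N.subst σ)
  | σ, proj i M => proj i (M.subst σ)
  | σ, copy V M P Q => copy V (M.subst σ) (P.subst (up σ)) (Q.subst (up σ))

def single (N : Term) : ℕ → Term
  | 0 => N
  | n + 1 => var n

/-- `M[N/x]`, where `x` is index `0` of `M`. -/
def inst (M N : Term) : Term := M.subst (single N)

/-- Free variables. -/
def fv : Term → Set ℕ
  | var n => {n}
  | lam M => {n | n + 1 ∈ M.fv}
  | app M N => M.fv ∪ N.fv
  | pair M N => M.fv ∪ N.fv
  | proj _ M => M.fv
  | copy V M P Q => V.fv ∪ M.fv ∪ {n | n + 1 ∈ P.fv} ∪ {n | n + 1 ∈ Q.fv}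

/-- The grammar `U ::= x | λx.U | U U | ⟨U, U⟩`. -/
inductive Pure : Term → Prop
  | var (n : ℕ) : Pure (var n)
  | lam {M : Term} : Pure M → Pure (lam M)
  | app {M N : Term} : Pure M → Pure N → Pure (app M N)
  | pair {M N : Term} : Pure M → Pure N → Pure (pair M N)

/-- One-step reduction generated by `(λx.M) N → M[N/x]` in any context of the grammar `Pure`. -/
inductive Beta : Term → Term → Prop
  | beta (M N : Term) : Beta (app (lam M) N) (M.inst N)
  | lam {M M' : Term} : Beta M M' → Beta (lam M) (lam M')
  | app_left {M M' : Term} (N : Term) : Beta M M' → Beta (app M N) (app M' N)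
  | app_right (M : Term) {N N' : Term} : Beta N N' → Beta (app M N) (app M N')
  | pair_left {M M' : Term} (N : Term) : Beta M M' → Beta (pair M N) (pair M' N)
  | pair_right (M : Term) {N N' : Term} : Beta N N' → Beta (pair M N) (pair M N')

/-- Values: closed normal terms free from `copy` and projections. -/
def IsValue (V : Term) : Prop := V.fv = ∅ ∧ Pure V ∧ ∀ W, ¬ Beta V W

end Term

/-! ### Contexts -/

/-- A context is a finite multiset of assumptions `x : A`. -/
abbrev Ctx : Type := Multiset (ℕ × Ty)

namespace Ctx

/-- The assumption names of a context. -/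
def dom (Γ : Ctx) : Set ℕ := {x | ∃ A, (x, A) ∈ Γ}

/-- The free type variables of a context. -/
def fv (Γ : Ctx) : Set ℕ := {a | ∃ p ∈ Γ, a ∈ p.2.fv}

/-- The context seen from below one binder of an assumption: name `x` becomes `x + 1`. -/
def shift (Γ : Ctx) : Ctx := Γ.map fun p => (p.1 + 1, p.2)

/-- The context seen from below one binder of a type variable. -/
def tshift (Γ : Ctx) : Ctx := Γ.map fun p => (p.1, p.2.rename Nat.succ)

end Ctx

/-- `A₁, …, Aₙ ⊢ B` is a `∀`-lazy judgement if `A₁ ⊸ … ⊸ Aₙ ⊸ B` is a `∀`-lazy type (for every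
enumeration `A₁, …, Aₙ` of the context; the order does not matter). -/
def ForallLazyJudgement (Γ : Ctx) (B : Ty) : Prop :=
  ∀ l : List Ty, (l : Multiset Ty) = Γ.map Prod.snd → (l.foldr Ty.lolli B).ForallLazy

/-! ### Derivations -/

/-- Derivation trees.  A node is an instance of a rule, with the names and the formulas that its
premises do not determine.  In each premise with an active assumption (the right premise of `cut`
and `⊸L`, the premise of `⊸R`, `&Li` and `∀L`, the first two premises of `&R1`) that assumption has
name `0` and the name `x` of the conclusion is `x + 1` there.
* `lolL y D E`, `ampL i y A₁ A₂ D`, `allL y A B D` have the main assumptions `y : _ ⊸ _`,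
  `y : A₁ & A₂` and `y : ∀α.A`, the last one instantiated with `B`;
* `ampR1 x D₁ D₂ D₃` has the main assumption `x`, and `D₃` is the derivation of `⊢ V : A`;
* `allR` binds the type variable `0` in its premise. -/
inductive Drv : Type
  | ax (x : ℕ) (A : Ty)
  | cut (D E : Drv)
  | lolR (D : Drv)
  | lolL (y : ℕ) (D E : Drv)
  | ampR0 (D E : Drv)
  | ampL (i : Side) (y : ℕ) (A₁ A₂ : Ty) (D : Drv)
  | ampR1 (x : ℕ) (D₁ D₂ D₃ : Drv)
  | allR (D : Drv)
  | allL (y : ℕ) (A B : Ty) (D : Drv)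

namespace Drv

/-- The size `|D|`: the number of rule instances. -/
def size : Drv → ℕ
  | ax _ _ => 1
  | cut D E => D.size + E.size + 1
  | lolR D => D.size + 1
  | lolL _ D E => D.size + E.size + 1
  | ampR0 D E => D.size + E.size + 1
  | ampL _ _ _ _ D => D.size + 1
  | ampR1 _ D₁ D₂ D₃ => D₁.size + D₂.size + D₃.size + 1
  | allR D => D.size + 1
  | allL _ _ _ D => D.size + 1

/-- `HasCut P D`: some instance of `cut` in `D`, with the subderivations `L` and `R` of its
premises, satisfies `P L R`. -/
def HasCut (P : Drv → Drv → Prop) : Drv → Prop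
  | ax _ _ => False
  | cut D E => P D E ∨ D.HasCut P ∨ E.HasCut P
  | lolR D => D.HasCut P
  | lolL _ D E => D.HasCut P ∨ E.HasCut P
  | ampR0 D E => D.HasCut P ∨ E.HasCut P
  | ampL _ _ _ _ D => D.HasCut P
  | ampR1 _ D₁ D₂ D₃ => D₁.HasCut P ∨ D₂.HasCut P ∨ D₃.HasCut P
  | allR D => D.HasCut P
  | allL _ _ _ D => D.HasCut P

def CutFree (D : Drv) : Prop := ¬ D.HasCut fun _ _ => True

/-- All axioms are atomic, i.e. of the form `x : α ⊢ x : α` with `α` a type variable. -/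
def AtomicAxioms : Drv → Prop
  | ax _ A => ∃ n, A = Ty.var n
  | cut D E => D.AtomicAxioms ∧ E.AtomicAxioms
  | lolR D => D.AtomicAxioms
  | lolL _ D E => D.AtomicAxioms ∧ E.AtomicAxioms
  | ampR0 D E => D.AtomicAxioms ∧ E.AtomicAxioms
  | ampL _ _ _ _ D => D.AtomicAxioms
  | ampR1 _ D₁ D₂ D₃ => D₁.AtomicAxioms ∧ D₂.AtomicAxioms ∧ D₃.AtomicAxioms
  | allR D => D.AtomicAxioms
  | allL _ _ _ D => D.AtomicAxioms

/-- The assumption names of the conclusion. -/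
def dom : Drv → Set ℕ
  | ax x _ => {x}
  | cut D E => D.dom ∪ {n | n + 1 ∈ E.dom}
  | lolR D => {n | n + 1 ∈ D.dom}
  | lolL y D E => {y} ∪ D.dom ∪ {n | n + 1 ∈ E.dom}
  | ampR0 _ _ => ∅
  | ampL _ y _ _ D => {y} ∪ {n | n + 1 ∈ D.dom}
  | ampR1 x _ _ _ => {x}
  | allR D => D.dom
  | allL y _ _ D => {y} ∪ {n | n + 1 ∈ D.dom}

/-- Rename the assumptions of the conclusion.  The premises of `&R0` and `&R1` have no assumption
other than the active one. -/
def rename : (ℕ → ℕ) → Drv → Drv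
  | ρ, ax x A => ax (ρ x) A
  | ρ, cut D E => cut (D.rename ρ) (E.rename (Ty.upr ρ))
  | ρ, lolR D => lolR (D.rename (Ty.upr ρ))
  | ρ, lolL y D E => lolL (ρ y) (D.rename ρ) (E.rename (Ty.upr ρ))
  | _, ampR0 D E => ampR0 D E
  | ρ, ampL i y A₁ A₂ D => ampL i (ρ y) A₁ A₂ (D.rename (Ty.upr ρ))
  | ρ, ampR1 x D₁ D₂ D₃ => ampR1 (ρ x) D₁ D₂ D₃
  | ρ, allR D => allR (D.rename ρ)
  | ρ, allL y A B D => allL (ρ y) A B (D.rename (Ty.upr ρ))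

/-- Substitute types for the free type variables of all formulas of a derivation. -/
def tsubst : (ℕ → Ty) → Drv → Drv
  | σ, ax x A => ax x (A.subst σ)
  | σ, cut D E => cut (D.tsubst σ) (E.tsubst σ)
  | σ, lolR D => lolR (D.tsubst σ)
  | σ, lolL y D E => lolL y (D.tsubst σ) (E.tsubst σ)
  | σ, ampR0 D E => ampR0 (D.tsubst σ) (E.tsubst σ)
  | σ, ampL i y A₁ A₂ D => ampL i y (A₁.subst σ) (A₂.subst σ) (D.tsubst σ)
  | σ, ampR1 x D₁ D₂ D₃ => ampR1 x (D₁.tsubst σ) (D₂.tsubst σ) (D₃.tsubst σ)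
  | σ, allR D => allR (D.tsubst (Ty.up σ))
  | σ, allL y A B D => allL y (A.subst (Ty.up σ)) (B.subst σ) (D.tsubst σ)

end Drv

/-- The typing rules: `Derives cl D Γ M A` says that `D` is a derivation of `Γ ⊢ M : A`.  The two
closure conditions on `⊸L` and `∀R` are imposed if `cl` holds.  The names of the assumptions of a
conclusion are distinct (linear constraint). -/
inductive Derives (cl : Prop) : Drv → Ctx → Term → Ty → Prop
  | ax (x : ℕ) (A : Ty) : Derives cl (.ax x A) {(x, A)} (.var x) A
  | cut {D E : Drv} {Γ Δ : Ctx} {N M : Term} {A C : Ty} :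
      Derives cl D Γ N A → Derives cl E ((0, A) ::ₘ Δ.shift) M C →
      Disjoint Γ.dom Δ.dom →
      Derives cl (.cut D E) (Γ + Δ) (M.inst N) C
  | lolR {D : Drv} {Γ : Ctx} {M : Term} {A B : Ty} :
      Derives cl D ((0, A) ::ₘ Γ.shift) M B →
      Derives cl (.lolR D) Γ (.lam M) (.lolli A B)
  | lolL {y : ℕ} {D E : Drv} {Γ Δ : Ctx} {N M : Term} {A B C : Ty} :
      Derives cl D Γ N A → Derives cl E ((0, B) ::ₘ Δ.shift) M C →
      Disjoint Γ.dom Δ.dom → y ∉ Γ.dom → y ∉ Δ.dom →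
      (cl → B.fv = ∅ → A.fv = ∅) →
      Derives cl (.lolL y D E) ((y, .lolli A B) ::ₘ (Γ + Δ)) (M.inst (.app (.var y) N)) C
  | ampR0 {D E : Drv} {M₁ M₂ : Term} {A₁ A₂ : Ty} :
      Derives cl D 0 M₁ A₁ → Derives cl E 0 M₂ A₂ →
      A₁.Closed → A₁.ForallLazy → A₂.Closed → A₂.ForallLazy →
      Derives cl (.ampR0 D E) 0 (.pair M₁ M₂) (.amp A₁ A₂)
  | ampL {i : Side} {y : ℕ} {D : Drv} {Γ : Ctx} {M : Term} {A₁ A₂ C : Ty} :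
      Derives cl D ((0, i.pick A₁ A₂) ::ₘ Γ.shift) M C →
      y ∉ Γ.dom →
      A₁.Closed → A₁.ForallLazy → A₂.Closed → A₂.ForallLazy →
      Derives cl (.ampL i y A₁ A₂ D) ((y, .amp A₁ A₂) ::ₘ Γ) (M.inst (.proj i (.var y))) C
  | ampR1 {x : ℕ} {D₁ D₂ D₃ : Drv} {M₁ M₂ V : Term} {A A₁ A₂ : Ty} :
      Derives cl D₁ {(0, A)} M₁ A₁ → Derives cl D₂ {(0, A)} M₂ A₂ → Derives cl D₃ 0 V A →
      V.IsValue →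
      A.Closed → A.ForallLazy → A₁.Closed → A₁.ForallLazy → A₂.Closed → A₂.ForallLazy →
      -- the derivation of the third premise is `η`-expanded
      D₃.CutFree → D₃.AtomicAxioms →
      Derives cl (.ampR1 x D₁ D₂ D₃) {(x, A)} (.copy V (.var x) M₁ M₂) (.amp A₁ A₂)
  | allR {D : Drv} {Γ : Ctx} {M : Term} {A : Ty} :
      Derives cl D Γ.tshift M A →
      (cl → (Ty.all A).fv = ∅ → Γ.fv = ∅) →
      Derives cl (.allR D) Γ M (.all A)
  | allL {y : ℕ} {D : Drv} {Γ : Ctx} {M : Term} {A B C : Ty} :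
      Derives cl D ((0, A.inst B) ::ₘ Γ.shift) M C →
      y ∉ Γ.dom →
      Derives cl (.allL y A B D) ((y, .all A) ::ₘ Γ) (M.inst (.var y)) C

/-- `D` is a derivation of `Γ ⊢ M : A` in the system `LAM`. -/
abbrev IsDerivation : Drv → Ctx → Term → Ty → Prop := Derives True

/-- `D` is a derivation of `Γ ⊢ M : A` by the rules of `LAM` without the closure conditions. -/
abbrev IsPreDerivation : Drv → Ctx → Term → Ty → Prop := Derives False

/-! ### Classes of cuts

The cut formula is the assumption named `0` in the right premise. -/

/-- Symmetric cuts. -/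
inductive SymmetricCut : Drv → Drv → Prop
  | ax_left (x : ℕ) (A : Ty) (E : Drv) : SymmetricCut (.ax x A) E
  | ax_right (D : Drv) (x : ℕ) (A : Ty) : SymmetricCut D (.ax x A)
  | lolli (D P Q : Drv) : SymmetricCut (.lolR D) (.lolL 0 P Q)
  | amp (D₁ D₂ : Drv) (i : Side) (A₁ A₂ : Ty) (Q : Drv) :
      SymmetricCut (.ampR0 D₁ D₂) (.ampL i 0 A₁ A₂ Q)
  | all (D : Drv) (A B : Ty) (Q : Drv) : SymmetricCut (.allR D) (.allL 0 A B Q)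

/-- Copy-first cuts `(&R1, &Li)`. -/
inductive CopyFirstCut : Drv → Drv → Prop
  | mk (x : ℕ) (D₁ D₂ D₃ : Drv) (i : Side) (A₁ A₂ : Ty) (Q : Drv) :
      CopyFirstCut (.ampR1 x D₁ D₂ D₃) (.ampL i 0 A₁ A₂ Q)

/-- Critical cuts `(X, &R1)`. -/
inductive CriticalCut : Drv → Drv → Prop
  | mk (L : Drv) (x : ℕ) (D₁ D₂ D₃ : Drv) : CriticalCut L (.ampR1 x D₁ D₂ D₃)

/-- Commuting cuts: all the others. -/
def CommutingCut (L R : Drv) : Prop :=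
  ¬ SymmetricCut L R ∧ ¬ CopyFirstCut L R ∧ ¬ CriticalCut L R

/-- The last rule is `cut`. -/
def Drv.EndsWithCut (D : Drv) : Prop := ∃ L R, D = .cut L R

/-! ### Cut-elimination steps -/

/-- Name `0` becomes `x` and the other names are lowered. -/
def bindName (x : ℕ) : ℕ → ℕ
  | 0 => x
  | n + 1 => n

/-- Exchange the names `0` and `1`. -/
def swapNames : ℕ → ℕ
  | 0 => 1
  | 1 => 0
  | n + 2 => n + 2

/-- Weaken a derivation by a new type variable `0`. -/
def Drv.tshift (D : Drv) : Drv := D.tsubst fun n => .var (n + 1)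

/-- Elimination of a symmetric cut that is the last rule.  (Renaming by `Nat.pred` removes the
name `0`, which does not occur in the renamed derivation.) -/
inductive SymmetricRule : Drv → Drv → Prop
  | ax_right (D : Drv) (A : Ty) : SymmetricRule (.cut D (.ax 0 A)) D
  | ax_left (x : ℕ) (A : Ty) (E : Drv) :
      SymmetricRule (.cut (.ax x A) E) (E.rename (bindName x))
  | lolli (D P Q : Drv) :
      SymmetricRule (.cut (.lolR D) (.lolL 0 P Q))
        (.cut (.cut (P.rename Nat.pred) D) (Q.rename (Ty.upr Nat.pred)))
  | amp (D₁ D₂ : Drv) (i : Side) (A₁ A₂ : Ty) (Q : Drv) :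
      SymmetricRule (.cut (.ampR0 D₁ D₂) (.ampL i 0 A₁ A₂ Q))
        (.cut (i.pick D₁ D₂) (Q.rename (Ty.upr Nat.pred)))
  | all (D : Drv) (A B : Ty) (Q : Drv) :
      SymmetricRule (.cut (.allR D) (.allL 0 A B Q))
        (.cut (D.tsubst (Ty.single B)) (Q.rename (Ty.upr Nat.pred)))

/-- Elimination of a ready cut that is the last rule: the left premise has no assumptions and a
cut-free derivation. -/
inductive ReadyRule : Drv → Drv → Prop
  | mk (D D₁ D₂ D₃ : Drv) : D.dom = ∅ → D.CutFree →
      ReadyRule (.cut D (.ampR1 0 D₁ D₂ D₃)) (.ampR0 (.cut D D₁) (.cut D D₂))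

/-- Permutation of a cut upwards, over the last rule of its right premise (first group) or of its
left premise (second group), when the cut formula is not introduced by that rule. -/
inductive PermutationRule : Drv → Drv → Prop
  | right_cut_left (L P Q : Drv) : 0 ∈ P.dom →
      PermutationRule (.cut L (.cut P Q)) (.cut (.cut L P) (Q.rename (Ty.upr Nat.pred)))
  | right_cut_right (L P Q : Drv) : 1 ∈ Q.dom →
      PermutationRule (.cut L (.cut P Q))
        (.cut (P.rename Nat.pred) (.cut (L.rename Nat.succ) (Q.rename swapNames)))
  | right_lolR (L Q : Drv) :
      PermutationRule (.cut L (.lolR Q))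
        (.lolR (.cut (L.rename Nat.succ) (Q.rename swapNames)))
  | right_lolL_left (L : Drv) (y : ℕ) (P Q : Drv) : 0 ∈ P.dom →
      PermutationRule (.cut L (.lolL (y + 1) P Q))
        (.lolL y (.cut L P) (Q.rename (Ty.upr Nat.pred)))
  | right_lolL_right (L : Drv) (y : ℕ) (P Q : Drv) : 1 ∈ Q.dom →
      PermutationRule (.cut L (.lolL (y + 1) P Q))
        (.lolL y (P.rename Nat.pred) (.cut (L.rename Nat.succ) (Q.rename swapNames)))
  | right_ampL (L : Drv) (i : Side) (y : ℕ) (A₁ A₂ : Ty) (Q : Drv) :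
      PermutationRule (.cut L (.ampL i (y + 1) A₁ A₂ Q))
        (.ampL i y A₁ A₂ (.cut (L.rename Nat.succ) (Q.rename swapNames)))
  | right_allR (L Q : Drv) :
      PermutationRule (.cut L (.allR Q)) (.allR (.cut L.tshift Q))
  | right_allL (L : Drv) (y : ℕ) (A B : Ty) (Q : Drv) :
      PermutationRule (.cut L (.allL (y + 1) A B Q))
        (.allL y A B (.cut (L.rename Nat.succ) (Q.rename swapNames)))
  | left_cut (P Q R : Drv) :
      PermutationRule (.cut (.cut P Q) R) (.cut P (.cut Q (R.rename (Ty.upr Nat.succ))))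
  | left_lolL (y : ℕ) (P Q R : Drv) :
      PermutationRule (.cut (.lolL y P Q) R)
        (.lolL y P (.cut Q (R.rename (Ty.upr Nat.succ))))
  | left_ampL (i : Side) (y : ℕ) (A₁ A₂ : Ty) (Q R : Drv) :
      PermutationRule (.cut (.ampL i y A₁ A₂ Q) R)
        (.ampL i y A₁ A₂ (.cut Q (R.rename (Ty.upr Nat.succ))))
  | left_allL (y : ℕ) (A B : Ty) (Q R : Drv) :
      PermutationRule (.cut (.allL y A B Q) R)
        (.allL y A B (.cut Q (R.rename (Ty.upr Nat.succ))))

/-- Elimination of a commuting cut that is the last rule. -/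
inductive CommutingRule : Drv → Drv → Prop
  | mk {L R D : Drv} : CommutingCut L R → PermutationRule (.cut L R) D →
      CommutingRule (.cut L R) D

/-- Apply a rule to some subderivation.  (The third premise of `&R1` is cut-free.) -/
inductive InContext (rule : Drv → Drv → Prop) : Drv → Drv → Prop
  | root {D D' : Drv} : rule D D' → InContext rule D D'
  | cut_left {D D' : Drv} (E : Drv) :
      InContext rule D D' → InContext rule (.cut D E) (.cut D' E)
  | cut_right (D : Drv) {E E' : Drv} :
      InContext rule E E' → InContext rule (.cut D E) (.cut D E')
  | lolR {D D' : Drv} : InContext rule D D' → InContext rule (.lolR D) (.lolR D')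
  | lolL_left (y : ℕ) {D D' : Drv} (E : Drv) :
      InContext rule D D' → InContext rule (.lolL y D E) (.lolL y D' E)
  | lolL_right (y : ℕ) (D : Drv) {E E' : Drv} :
      InContext rule E E' → InContext rule (.lolL y D E) (.lolL y D E')
  | ampR0_left {D D' : Drv} (E : Drv) :
      InContext rule D D' → InContext rule (.ampR0 D E) (.ampR0 D' E)
  | ampR0_right (D : Drv) {E E' : Drv} :
      InContext rule E E' → InContext rule (.ampR0 D E) (.ampR0 D E')
  | ampL (i : Side) (y : ℕ) (A₁ A₂ : Ty) {D D' : Drv} :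
      InContext rule D D' → InContext rule (.ampL i y A₁ A₂ D) (.ampL i y A₁ A₂ D')
  | ampR1_left (x : ℕ) {D₁ D₁' : Drv} (D₂ D₃ : Drv) :
      InContext rule D₁ D₁' → InContext rule (.ampR1 x D₁ D₂ D₃) (.ampR1 x D₁' D₂ D₃)
  | ampR1_right (x : ℕ) (D₁ : Drv) {D₂ D₂' : Drv} (D₃ : Drv) :
      InContext rule D₂ D₂' → InContext rule (.ampR1 x D₁ D₂ D₃) (.ampR1 x D₁ D₂' D₃)
  | allR {D D' : Drv} : InContext rule D D' → InContext rule (.allR D) (.allR D')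
  | allL (y : ℕ) (A B : Ty) {D D' : Drv} :
      InContext rule D D' → InContext rule (.allL y A B D) (.allL y A B D')

/-- One `∀`-lazy cut-elimination step on a commuting cut. -/
abbrev CommutingStep : Drv → Drv → Prop := InContext CommutingRule

/-- One `∀`-lazy cut-elimination step on a symmetric cut. -/
abbrev SymmetricStep : Drv → Drv → Prop := InContext SymmetricRule

/-- One `∀`-lazy cut-elimination step on a ready cut. -/
abbrev ReadyStep : Drv → Drv → Prop := InContext ReadyRule

/-- One `∀`-lazy cut-elimination step. -/
def Step (D D' : Drv) : Prop := CommutingStep D D' ∨ SymmetricStep D D' ∨ ReadyStep D D'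

/-- `CommutingSteps k D D'`: exactly `k` steps on commuting cuts lead from `D` to `D'`. -/
inductive CommutingSteps : ℕ → Drv → Drv → Prop
  | refl (D : Drv) : CommutingSteps 0 D D
  | step {k : ℕ} {D D' D'' : Drv} : CommutingStep D D' → CommutingSteps k D' D'' →
      CommutingSteps (k + 1) D D''

/-- The end of the first phase of a round: the only commuting cuts that remain are those with a
premise that is itself the conclusion of a `cut`. -/
def CommutingPhaseDone (D : Drv) : Prop :=
  ¬ D.HasCut fun L R => CommutingCut L R ∧ ¬ L.EndsWithCut ∧ ¬ R.EndsWithCut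

/-- The second phase of a round: eliminate a symmetric cut if there is one, and otherwise a
ready cut. -/
def SecondPhase (D D' : Drv) : Prop :=
  SymmetricStep D D' ∨ (¬ D.HasCut SymmetricCut ∧ ReadyStep D D')

/-- `Rounds n D D'`: the round-based strategy leads from `D` to `D'` in a finite number of rounds
consisting of exactly `n` cut-elimination steps altogether. -/
inductive Rounds : ℕ → Drv → Drv → Prop
  | nil (D : Drv) : Rounds 0 D D
  | round {k n : ℕ} {D D₁ D₂ D' : Drv} :
      CommutingSteps k D D₁ → CommutingPhaseDone D₁ → SecondPhase D₁ D₂ → Rounds n D₂ D' →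
      Rounds (k + 1 + n) D D'

end LAM

/-! The proof rests on a rigidity property of lazy judgements. A type without positive `∀` has a
free variable: following right components leads to a variable that no quantifier binds
(`Ty.NoAll.fv_ne_empty`). The assumptions of a lazy judgement have no positive `∀`, so none of them
is closed. Hence `&Li`, `&R1` and `∀L` cannot conclude a lazy judgement, and a cut-free lazy
derivation uses only axioms, `⊸R`, `⊸L`, `&R0` and `∀R` (`Proves.lazyProves`).

This fragment has three useful features. A closed conclusion forces an empty context
(`LazyProves.eq_zero_of_closed`), so a critical cut whose left premise is lazy and cut-free is
ready. Twice the size is bounded by the weight of the judgement, with equality when the axioms are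
atomic, so the derivation duplicated by a ready step is no larger than the derivation of `V` which
that step discards. Finally, the closure conditions hold automatically (`LazyProves.proves`),
although steps may break them on the way. Subject reduction is therefore proved without them, and
they are recovered only at the end.

For the count, let the potential be the size with `&R1` counted three times. Commuting steps
preserve it; symmetric and ready steps decrease it strictly. So there are linearly many rounds. Each
commuting phase is quadratic (`exists_normal`): cuts are first moved up their right premise until
the cut formula is introduced, then up the left rules of their left premise. The second kind of move
is paid for by pairs of a cut and a logical rule above its left premise.

The strategy does not get stuck. In the resulting normal form a commuting cut always has a cut above
its left premise, and if cuts remain but none is symmetric, then a search through lazy judgements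
and left premises of cuts meets a ready cut (`exists_readyStep`). Copy-first cuts do not block this
search: they would put a closed type in a lazy context. -/

namespace LAM

/-! ### Contexts -/

namespace Ctx

/-- Rename the assumptions of a context. -/
def ren (ρ : ℕ → ℕ) (Γ : Ctx) : Ctx := Γ.map fun p => (ρ p.1, p.2)

/-- Substitute types for the free type variables of a context. -/
def tsub (σ : ℕ → Ty) (Γ : Ctx) : Ctx := Γ.map fun p => (p.1, p.2.subst σ)

@[simp] theorem dom_zero : dom 0 = ∅ := by simp [dom]

@[simp] theorem dom_singleton (x : ℕ) (A : Ty) : dom {(x, A)} = {x} := by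
  ext; simp [dom]

@[simp] theorem dom_add (Γ Δ : Ctx) : dom (Γ + Δ) = dom Γ ∪ dom Δ := by
  ext; simp [dom, exists_or]

@[simp] theorem dom_cons (x : ℕ) (A : Ty) (Γ : Ctx) : dom ((x, A) ::ₘ Γ) = {x} ∪ dom Γ := by
  ext; simp [dom, exists_or]

theorem dom_ren (ρ : ℕ → ℕ) (Γ : Ctx) : dom (ren ρ Γ) = ρ '' dom Γ := by
  ext x; simp only [dom, ren, Multiset.mem_map, Prod.exists, Prod.mk.injEq, Set.mem_image,
    Set.mem_ofPred_eq]
  constructor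
  · rintro ⟨A, y, B, h, rfl, rfl⟩; exact ⟨y, ⟨_, h⟩, rfl⟩
  · rintro ⟨y, ⟨A, h⟩, rfl⟩; exact ⟨A, y, A, h, rfl, rfl⟩

theorem shift_eq_ren (Γ : Ctx) : Γ.shift = Γ.ren Nat.succ := rfl

@[simp] theorem dom_shift (Γ : Ctx) : dom Γ.shift = Nat.succ '' dom Γ := dom_ren _ Γ

@[simp] theorem dom_tsub (σ : ℕ → Ty) (Γ : Ctx) : dom (tsub σ Γ) = dom Γ := by
  ext x; simp [dom, tsub]

@[simp] theorem dom_tshift (Γ : Ctx) : dom Γ.tshift = dom Γ := by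
  ext x; simp [dom, tshift]

@[simp] theorem shift_zero : shift 0 = 0 := rfl
@[simp] theorem shift_add (Γ Δ : Ctx) : shift (Γ + Δ) = shift Γ + shift Δ := by simp [shift]
@[simp] theorem shift_cons (x : ℕ) (A : Ty) (Γ : Ctx) :
    shift ((x, A) ::ₘ Γ) = (x + 1, A) ::ₘ shift Γ := by simp [shift]

@[simp] theorem ren_add (ρ : ℕ → ℕ) (Γ Δ : Ctx) : ren ρ (Γ + Δ) = ren ρ Γ + ren ρ Δ := by
  simp [ren]
@[simp] theorem ren_cons (ρ : ℕ → ℕ) (x : ℕ) (A : Ty) (Γ : Ctx) :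
    ren ρ ((x, A) ::ₘ Γ) = (ρ x, A) ::ₘ ren ρ Γ := by simp [ren]
@[simp] theorem ren_singleton (ρ : ℕ → ℕ) (x : ℕ) (A : Ty) :
    ren ρ {(x, A)} = {(ρ x, A)} := by simp [ren]

@[simp] theorem tshift_add (Γ Δ : Ctx) : tshift (Γ + Δ) = tshift Γ + tshift Δ := by simp [tshift]
@[simp] theorem tshift_cons (x : ℕ) (A : Ty) (Γ : Ctx) :
    tshift ((x, A) ::ₘ Γ) = (x, A.rename Nat.succ) ::ₘ tshift Γ := by simp [tshift]

@[simp] theorem tsub_zero (σ : ℕ → Ty) : tsub σ 0 = 0 := rfl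
@[simp] theorem tsub_add (σ : ℕ → Ty) (Γ Δ : Ctx) : tsub σ (Γ + Δ) = tsub σ Γ + tsub σ Δ := by
  simp [tsub]
@[simp] theorem tsub_cons (σ : ℕ → Ty) (x : ℕ) (A : Ty) (Γ : Ctx) :
    tsub σ ((x, A) ::ₘ Γ) = (x, A.subst σ) ::ₘ tsub σ Γ := by simp [tsub]
@[simp] theorem tsub_singleton (σ : ℕ → Ty) (x : ℕ) (A : Ty) :
    tsub σ {(x, A)} = {(x, A.subst σ)} := by simp [tsub]

@[simp] theorem tsub_shift (σ : ℕ → Ty) (Γ : Ctx) : tsub σ Γ.shift = (tsub σ Γ).shift := by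
  simp [tsub, shift]

@[simp] theorem ren_tshift (ρ : ℕ → ℕ) (Γ : Ctx) : ren ρ Γ.tshift = (ren ρ Γ).tshift := by
  simp [ren, tshift]

theorem shift_tshift (Γ : Ctx) : Γ.tshift.shift = Γ.shift.tshift := by
  simp [shift, tshift]

@[simp] theorem ren_upr_shift (ρ : ℕ → ℕ) (Γ : Ctx) :
    ren (Ty.upr ρ) Γ.shift = (ren ρ Γ).shift := by
  simp [ren, shift, Ty.upr]

@[simp] theorem ren_pred_shift (Γ : Ctx) : ren Nat.pred Γ.shift = Γ := by
  simp [ren, shift]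

@[simp] theorem ren_swap_shift_shift (Γ : Ctx) : ren swapNames Γ.shift.shift = Γ.shift.shift := by
  simp [ren, shift, swapNames]

@[simp] theorem ren_bindName_shift (x : ℕ) (Γ : Ctx) : ren (bindName x) Γ.shift = Γ := by
  simp [ren, shift, bindName]

theorem shift_injective : Function.Injective shift :=
  Function.LeftInverse.injective (g := ren Nat.pred) ren_pred_shift

/-! ### Locating the active assumption `0` in equations between contexts -/

theorem zero_notMem_dom_shift (Γ : Ctx) : 0 ∉ dom Γ.shift := by simp

theorem mem_dom {x : ℕ} {A : Ty} {Γ : Ctx} (h : (x, A) ∈ Γ) : x ∈ dom Γ := ⟨A, h⟩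

theorem shift_ren_pred {Γ : Ctx} (h : 0 ∉ dom Γ) : (ren Nat.pred Γ).shift = Γ := by
  simp only [ren, shift, Multiset.map_map]
  conv_rhs => rw [← Multiset.map_id Γ]
  refine Multiset.map_congr rfl fun p hp => ?_
  rcases p with ⟨x, A⟩
  cases x with
  | zero => exact absurd (mem_dom hp) h
  | succ n => rfl

theorem exists_shift {Γ : Ctx} (h : 0 ∉ dom Γ) : ∃ Γ', Γ = shift Γ' := ⟨_, (shift_ren_pred h).symm⟩

theorem eq_zero_of_dom_eq_empty {Γ : Ctx} (h : dom Γ = ∅) : Γ = 0 := by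
  refine Multiset.eq_zero_of_forall_notMem fun p hp => ?_
  have := mem_dom (x := p.1) (A := p.2) hp
  rw [h] at this; exact this

theorem shift_eq_add {Δ X Y : Ctx} (h : Δ.shift = X + Y) :
    ∃ X' Y', X = shift X' ∧ Y = shift Y' ∧ Δ = X' + Y' := by
  have h0 := zero_notMem_dom_shift Δ
  rw [h, dom_add, Set.mem_union, not_or] at h0
  obtain ⟨X', rfl⟩ := exists_shift h0.1
  obtain ⟨Y', rfl⟩ := exists_shift h0.2
  exact ⟨X', Y', rfl, rfl, shift_injective (by simpa using h)⟩

theorem shift_eq_cons {Δ Z : Ctx} {y : ℕ} {T : Ty} (h : Δ.shift = (y + 1, T) ::ₘ Z) :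
    ∃ Z', Z = shift Z' ∧ Δ = (y, T) ::ₘ Z' := by
  have h0 := zero_notMem_dom_shift Δ
  rw [h, dom_cons, Set.mem_union, not_or] at h0
  obtain ⟨Z', rfl⟩ := exists_shift h0.2
  exact ⟨Z', rfl, shift_injective (by simpa using h)⟩

theorem cons_zero_shift_eq_cons_zero {A T : Ty} {Δ Z : Ctx}
    (h : (0, A) ::ₘ Δ.shift = (0, T) ::ₘ Z) : A = T ∧ Z = Δ.shift := by
  have hm : (0, T) ∈ (0, A) ::ₘ Δ.shift := h ▸ Multiset.mem_cons_self _ _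
  rcases Multiset.mem_cons.1 hm with e | e
  · cases e; exact ⟨rfl, ((Multiset.cons_inj_right _).1 h).symm⟩
  · exact absurd (mem_dom e) (zero_notMem_dom_shift _)

theorem cons_zero_shift_eq_cons_succ {A T : Ty} {Δ Z : Ctx} {y : ℕ}
    (h : (0, A) ::ₘ Δ.shift = (y + 1, T) ::ₘ Z) :
    ∃ Z', Z = (0, A) ::ₘ shift Z' ∧ Δ = (y, T) ::ₘ Z' := by
  have hm : (0, A) ∈ (y + 1, T) ::ₘ Z := h ▸ Multiset.mem_cons_self _ _
  rcases Multiset.mem_cons.1 hm with e | e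
  · cases e
  · obtain ⟨Z, rfl⟩ := Multiset.exists_cons_of_mem e
    rw [Multiset.cons_swap, Multiset.cons_inj_right] at h
    obtain ⟨Z', rfl, rfl⟩ := shift_eq_cons h
    exact ⟨Z', rfl, rfl⟩

theorem cons_zero_shift_eq_add_left {A : Ty} {Δ X Y : Ctx} (h : (0, A) ::ₘ Δ.shift = X + Y)
    (h0 : 0 ∈ dom X) :
    ∃ X' Y', X = (0, A) ::ₘ shift X' ∧ Y = shift Y' ∧ Δ = X' + Y' := by
  obtain ⟨B, hB⟩ := h0
  obtain ⟨X, rfl⟩ := Multiset.exists_cons_of_mem hB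
  rw [Multiset.cons_add] at h
  obtain ⟨rfl, h'⟩ := cons_zero_shift_eq_cons_zero h
  obtain ⟨X', Y', rfl, rfl, rfl⟩ := shift_eq_add h'.symm
  exact ⟨X', Y', rfl, rfl, rfl⟩

theorem cons_zero_shift_eq_add_right {A : Ty} {Δ X Y : Ctx} (h : (0, A) ::ₘ Δ.shift = X + Y)
    (h0 : 0 ∈ dom Y) :
    ∃ X' Y', X = shift X' ∧ Y = (0, A) ::ₘ shift Y' ∧ Δ = X' + Y' := by
  rw [add_comm] at h
  obtain ⟨Y', X', hY, hX, rfl⟩ := cons_zero_shift_eq_add_left h h0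
  exact ⟨X', Y', hX, hY, add_comm _ _⟩

end Ctx

theorem injOn_upr {ρ : ℕ → ℕ} {Γ : Ctx} {A : Ty} (h : Set.InjOn ρ Γ.dom) :
    Set.InjOn (Ty.upr ρ) (Ctx.dom ((0, A) ::ₘ Γ.shift)) := by
  intro x hx y hy hxy
  simp only [Ctx.dom_cons, Ctx.dom_shift, Set.mem_union, Set.mem_singleton_iff, Set.mem_image]
    at hx hy
  rcases hx with rfl | ⟨x, hx, rfl⟩ <;> rcases hy with rfl | ⟨y, hy, rfl⟩ <;>
    simp_all [Ty.upr]
  exact h hx hy hxy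

/-! ### Provability -/

/-- `D` is a derivation of `Γ ⊢ M : A` for some term `M`. -/
def Proves (cl : Prop) (D : Drv) (Γ : Ctx) (A : Ty) : Prop := ∃ M, Derives cl D Γ M A

/-! ### Inversion of the typing rules, with the term forgotten -/

section inversion

variable {cl : Prop} {Γ : Ctx} {C : Ty}

theorem proves_ax {x : ℕ} {A : Ty} :
    Proves cl (.ax x A) Γ C ↔ Γ = {(x, A)} ∧ C = A := by
  constructor
  · rintro ⟨M, h⟩; cases h; exact ⟨rfl, rfl⟩
  · rintro ⟨rfl, rfl⟩; exact ⟨_, .ax _ _⟩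

theorem proves_cut {D E : Drv} :
    Proves cl (.cut D E) Γ C ↔ ∃ Γ₁ Δ A, Proves cl D Γ₁ A ∧
      Proves cl E ((0, A) ::ₘ Ctx.shift Δ) C ∧ Disjoint (Ctx.dom Γ₁) (Ctx.dom Δ) ∧
      Γ = Γ₁ + Δ := by
  constructor
  · rintro ⟨M, h⟩; cases h with
    | cut h₁ h₂ h₃ => exact ⟨_, _, _, ⟨_, h₁⟩, ⟨_, h₂⟩, h₃, rfl⟩
  · rintro ⟨Γ₁, Δ, A, ⟨_, h₁⟩, ⟨_, h₂⟩, h₃, rfl⟩; exact ⟨_, .cut h₁ h₂ h₃⟩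

theorem proves_lolR {D : Drv} :
    Proves cl (.lolR D) Γ C ↔
      ∃ A B, Proves cl D ((0, A) ::ₘ Ctx.shift Γ) B ∧ C = .lolli A B := by
  constructor
  · rintro ⟨M, h⟩; cases h with
    | lolR h => exact ⟨_, _, ⟨_, h⟩, rfl⟩
  · rintro ⟨A, B, ⟨_, h⟩, rfl⟩; exact ⟨_, .lolR h⟩

theorem proves_lolL {y : ℕ} {D E : Drv} :
    Proves cl (.lolL y D E) Γ C ↔ ∃ Γ₁ Δ A B, Proves cl D Γ₁ A ∧
      Proves cl E ((0, B) ::ₘ Ctx.shift Δ) C ∧ Disjoint (Ctx.dom Γ₁) (Ctx.dom Δ) ∧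
      y ∉ Ctx.dom Γ₁ ∧ y ∉ Ctx.dom Δ ∧ (cl → B.fv = ∅ → A.fv = ∅) ∧
      Γ = (y, .lolli A B) ::ₘ (Γ₁ + Δ) := by
  constructor
  · rintro ⟨M, h⟩; cases h with
    | lolL h₁ h₂ h₃ h₄ h₅ h₆ => exact ⟨_, _, _, _, ⟨_, h₁⟩, ⟨_, h₂⟩, h₃, h₄, h₅, h₆, rfl⟩
  · rintro ⟨Γ₁, Δ, A, B, ⟨_, h₁⟩, ⟨_, h₂⟩, h₃, h₄, h₅, h₆, rfl⟩
    exact ⟨_, .lolL h₁ h₂ h₃ h₄ h₅ h₆⟩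

theorem proves_ampR0 {D E : Drv} :
    Proves cl (.ampR0 D E) Γ C ↔ ∃ A₁ A₂, Proves cl D 0 A₁ ∧ Proves cl E 0 A₂ ∧
      A₁.Closed ∧ A₁.ForallLazy ∧ A₂.Closed ∧ A₂.ForallLazy ∧ Γ = 0 ∧ C = .amp A₁ A₂ := by
  constructor
  · rintro ⟨M, h⟩; cases h with
    | ampR0 h₁ h₂ h₃ h₄ h₅ h₆ => exact ⟨_, _, ⟨_, h₁⟩, ⟨_, h₂⟩, h₃, h₄, h₅, h₆, rfl, rfl⟩
  · rintro ⟨A₁, A₂, ⟨_, h₁⟩, ⟨_, h₂⟩, h₃, h₄, h₅, h₆, rfl, rfl⟩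
    exact ⟨_, .ampR0 h₁ h₂ h₃ h₄ h₅ h₆⟩

theorem proves_ampL {i : Side} {y : ℕ} {A₁ A₂ : Ty} {D : Drv} :
    Proves cl (.ampL i y A₁ A₂ D) Γ C ↔ ∃ Δ,
      Proves cl D ((0, i.pick A₁ A₂) ::ₘ Ctx.shift Δ) C ∧ y ∉ Ctx.dom Δ ∧
      A₁.Closed ∧ A₁.ForallLazy ∧ A₂.Closed ∧ A₂.ForallLazy ∧
      Γ = (y, .amp A₁ A₂) ::ₘ Δ := by
  constructor
  · rintro ⟨M, h⟩; cases h with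
    | ampL h₁ h₂ h₃ h₄ h₅ h₆ => exact ⟨_, ⟨_, h₁⟩, h₂, h₃, h₄, h₅, h₆, rfl⟩
  · rintro ⟨Δ, ⟨_, h₁⟩, h₂, h₃, h₄, h₅, h₆, rfl⟩; exact ⟨_, .ampL h₁ h₂ h₃ h₄ h₅ h₆⟩

theorem proves_ampR1 {x : ℕ} {D₁ D₂ D₃ : Drv} :
    Proves cl (.ampR1 x D₁ D₂ D₃) Γ C ↔ ∃ A A₁ A₂, Proves cl D₁ {(0, A)} A₁ ∧
      Proves cl D₂ {(0, A)} A₂ ∧ (∃ V, Derives cl D₃ 0 V A ∧ V.IsValue) ∧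
      (A.Closed ∧ A.ForallLazy) ∧ (A₁.Closed ∧ A₁.ForallLazy ∧ A₂.Closed ∧ A₂.ForallLazy) ∧
      (D₃.CutFree ∧ D₃.AtomicAxioms) ∧ Γ = {(x, A)} ∧ C = .amp A₁ A₂ := by
  constructor
  · rintro ⟨M, h⟩; cases h with
    | ampR1 h₁ h₂ h₃ hV a b c d e f g h =>
      exact ⟨_, _, _, ⟨_, h₁⟩, ⟨_, h₂⟩, ⟨_, h₃, hV⟩, ⟨a, b⟩, ⟨c, d, e, f⟩, ⟨g, h⟩, rfl, rfl⟩
  · rintro ⟨A, A₁, A₂, ⟨_, h₁⟩, ⟨_, h₂⟩, ⟨_, h₃, hV⟩, ⟨a, b⟩, ⟨c, d, e, f⟩, ⟨g, h⟩, rfl, rfl⟩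
    exact ⟨_, .ampR1 h₁ h₂ h₃ hV a b c d e f g h⟩

theorem proves_allR {D : Drv} :
    Proves cl (.allR D) Γ C ↔ ∃ A, Proves cl D (Ctx.tshift Γ) A ∧
      (cl → (Ty.all A).fv = ∅ → Ctx.fv Γ = ∅) ∧ C = .all A := by
  constructor
  · rintro ⟨M, h⟩; cases h with
    | allR h₁ h₂ => exact ⟨_, ⟨_, h₁⟩, h₂, rfl⟩
  · rintro ⟨A, ⟨_, h₁⟩, h₂, rfl⟩; exact ⟨_, .allR h₁ h₂⟩

theorem proves_allL {y : ℕ} {A B : Ty} {D : Drv} :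
    Proves cl (.allL y A B D) Γ C ↔ ∃ Δ, Proves cl D ((0, A.inst B) ::ₘ Ctx.shift Δ) C ∧
      y ∉ Ctx.dom Δ ∧ Γ = (y, .all A) ::ₘ Δ := by
  constructor
  · rintro ⟨M, h⟩; cases h with
    | allL h₁ h₂ => exact ⟨_, ⟨_, h₁⟩, h₂, rfl⟩
  · rintro ⟨Δ, ⟨_, h₁⟩, h₂, rfl⟩; exact ⟨_, .allL h₁ h₂⟩

end inversion

theorem Derives.weaken {cl : Prop} {D : Drv} {Γ : Ctx} {M : Term} {A : Ty}
    (h : Derives cl D Γ M A) : Derives False D Γ M A := by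
  induction h with
  | ax x A => exact .ax x A
  | cut _ _ h h₁ h₂ => exact .cut h₁ h₂ h
  | lolR _ h => exact .lolR h
  | lolL _ _ h₃ h₄ h₅ _ h₁ h₂ => exact .lolL h₁ h₂ h₃ h₄ h₅ (fun h => h.elim)
  | ampR0 _ _ a b c d h₁ h₂ => exact .ampR0 h₁ h₂ a b c d
  | ampL _ a b c d e h => exact .ampL h a b c d e
  | ampR1 _ _ _ a b c d e f g i j h₁ h₂ h₃ => exact .ampR1 h₁ h₂ h₃ a b c d e f g i j
  | allR _ _ h => exact .allR h (fun h => h.elim)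
  | allL _ a h => exact .allL h a

/-- Permutation and ready rules test names on the bare tree; this transfers the tests to contexts.
-/
theorem Proves.dom_eq {cl : Prop} {D : Drv} {Γ : Ctx} {A : Ty} (h : Proves cl D Γ A) :
    D.dom = Γ.dom := by
  have key : ∀ (B : Ty) (Δ : Ctx), {n | n + 1 ∈ Ctx.dom ((0, B) ::ₘ Δ.shift)} = Δ.dom := by
    intro B Δ; ext n; simp
  obtain ⟨M, h⟩ := h
  induction h <;> simp_all [Drv.dom, Set.insert_union]

/-! ### Renaming of assumptions -/

/-- Injectivity is needed only on the names that occur, which is what keeps contexts disjoint. It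
allows non-injective maps such as `Nat.pred` and `bindName x`. -/
theorem Proves.rename {cl : Prop} {D : Drv} {Γ : Ctx} {A : Ty} (h : Proves cl D Γ A) {ρ : ℕ → ℕ}
    (hρ : Set.InjOn ρ Γ.dom) : Proves cl (D.rename ρ) (Γ.ren ρ) A := by
  have hdisj : ∀ {ρ : ℕ → ℕ} {Γ Δ : Ctx}, Set.InjOn ρ (Ctx.dom (Γ + Δ)) →
      Disjoint (Ctx.dom Γ) (Ctx.dom Δ) → Disjoint (Ctx.dom (Γ.ren ρ)) (Ctx.dom (Δ.ren ρ)) := by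
    intro ρ Γ Δ h h'
    rw [Ctx.dom_ren, Ctx.dom_ren]
    rw [Ctx.dom_add] at h
    rw [Set.disjoint_left] at h' ⊢
    rintro _ ⟨x, hx, rfl⟩ ⟨y, hy, e⟩
    exact h' hx (h (.inr hy) (.inl hx) e ▸ hy)
  have hnot : ∀ {ρ : ℕ → ℕ} {Γ Δ : Ctx} {y : ℕ} {T : Ty}, Set.InjOn ρ (Ctx.dom ((y, T) ::ₘ Γ)) →
      Δ ≤ Γ → y ∉ Ctx.dom Γ → ρ y ∉ Ctx.dom (Ctx.ren ρ Δ) := by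
    intro ρ Γ Δ y T h hle hy
    rw [Ctx.dom_ren]
    rintro ⟨x, ⟨B, hx⟩, e⟩
    have hx' := Multiset.mem_of_le hle hx
    have := h (by simp [Ctx.mem_dom hx']) (by simp) e
    exact hy (this ▸ Ctx.mem_dom hx')
  induction D generalizing Γ A ρ with
  | ax x A => 
    obtain ⟨rfl, rfl⟩ := proves_ax.1 h
    exact proves_ax.2 ⟨by simp, rfl⟩
  | cut D E ihD ihE =>
    obtain ⟨Γ₁, Δ, B, h₁, h₂, h₃, rfl⟩ := proves_cut.1 h
    refine proves_cut.2 ⟨Γ₁.ren ρ, Δ.ren ρ, B, ihD h₁ (hρ.mono (by simp)), ?_, hdisj hρ h₃, by simp⟩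
    simpa [Ty.upr] using ihE h₂ (injOn_upr (hρ.mono (by simp)))
  | lolR D ih =>
    obtain ⟨A, B, h₁, rfl⟩ := proves_lolR.1 h
    exact proves_lolR.2 ⟨A, B, by simpa [Ty.upr] using ih h₁ (injOn_upr hρ), rfl⟩
  | lolL y D E ihD ihE =>
    obtain ⟨Γ₁, Δ, A, B, h₁, h₂, h₃, h₄, h₅, h₆, rfl⟩ := proves_lolL.1 h
    have hy : y ∉ Ctx.dom (Γ₁ + Δ) := by simp [h₄, h₅]
    refine proves_lolL.2 ⟨Γ₁.ren ρ, Δ.ren ρ, A, B, ihD h₁ (hρ.mono (by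
      simp [Set.subset_def]; tauto)), ?_,
      hdisj (hρ.mono (by simp [Set.subset_def]; tauto)) h₃, hnot hρ (by simp) hy, hnot hρ (by simp) hy,
      h₆, by simp⟩
    simpa [Ty.upr] using ihE h₂ (injOn_upr (hρ.mono (by simp [Set.subset_def]; tauto)))
  | ampR0 D E =>
    obtain ⟨A₁, A₂, h₁, h₂, a, b, c, d, rfl, rfl⟩ := proves_ampR0.1 h
    exact h
  | ampL i y A₁ A₂ D ih =>
    obtain ⟨Δ, h₁, h₂, a, b, c, d, rfl⟩ := proves_ampL.1 h
    refine proves_ampL.2 ⟨Δ.ren ρ, ?_, hnot hρ le_rfl h₂, a, b, c, d, by simp⟩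
    simpa [Ty.upr] using ih h₁ (injOn_upr (hρ.mono (by simp)))
  | ampR1 x D₁ D₂ D₃ =>
    obtain ⟨A, A₁, A₂, h₁, h₂, h₃, a, b, c, rfl, rfl⟩ := proves_ampR1.1 h
    exact proves_ampR1.2 ⟨A, A₁, A₂, h₁, h₂, h₃, a, b, c, by simp, rfl⟩
  | allR D ih =>
    obtain ⟨A, h₁, h₂, rfl⟩ := proves_allR.1 h
    refine proves_allR.2 ⟨A, by simpa using ih h₁ (by simpa using hρ), fun hc hA => ?_, rfl⟩
    have := h₂ hc hA
    rw [← this]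
    ext a
    simp only [Ctx.fv, Ctx.ren, Multiset.mem_map]
    constructor
    · rintro ⟨_, ⟨p, hp, rfl⟩, ha⟩; exact ⟨p, hp, ha⟩
    · rintro ⟨p, hp, ha⟩; exact ⟨_, ⟨p, hp, rfl⟩, ha⟩
  | allL y A B D ih =>
    obtain ⟨Δ, h₁, h₂, rfl⟩ := proves_allL.1 h
    refine proves_allL.2 ⟨Δ.ren ρ, ?_, hnot hρ le_rfl h₂, by simp⟩
    simpa [Ty.upr] using ih h₁ (injOn_upr (hρ.mono (by simp)))

/-! ### The renamings that occur in cut-elimination steps -/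

section names

variable {cl : Prop} {D : Drv} {Γ : Ctx} {A B C : Ty}

theorem Proves.shift (h : Proves cl D Γ A) : Proves cl (D.rename Nat.succ) Γ.shift A :=
  h.rename Nat.succ_injective.injOn

theorem injOn_pred_dom_shift : Set.InjOn Nat.pred (Ctx.dom Γ.shift) := by
  rw [Ctx.dom_shift]
  rintro _ ⟨x, -, rfl⟩ _ ⟨y, -, rfl⟩ h
  simpa using h

theorem Proves.unshift (h : Proves cl D Γ.shift A) : Proves cl (D.rename Nat.pred) Γ A := by
  simpa using h.rename injOn_pred_dom_shift

theorem Proves.shift_one (h : Proves cl D ((0, A) ::ₘ Γ.shift) C) :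
    Proves cl (D.rename (Ty.upr Nat.succ)) ((0, A) ::ₘ Γ.shift.shift) C := by
  have := h.rename (injOn_upr (ρ := Nat.succ) Nat.succ_injective.injOn)
  simpa [Ty.upr, ← Ctx.shift_eq_ren] using this

theorem Proves.unshift_one (h : Proves cl D ((0, A) ::ₘ Γ.shift.shift) C) :
    Proves cl (D.rename (Ty.upr Nat.pred)) ((0, A) ::ₘ Γ.shift) C := by
  simpa [Ty.upr] using h.rename (injOn_upr injOn_pred_dom_shift)

theorem swapNames_swapNames : ∀ x, swapNames (swapNames x) = x
  | 0 => rfl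
  | 1 => rfl
  | _ + 2 => rfl

theorem Proves.swap (h : Proves cl D ((0, A) ::ₘ (1, B) ::ₘ Γ.shift.shift) C) :
    Proves cl (D.rename swapNames) ((0, B) ::ₘ (1, A) ::ₘ Γ.shift.shift) C := by
  have := h.rename (ρ := swapNames)
    (Function.LeftInverse.injective (g := swapNames) swapNames_swapNames).injOn
  rw [Multiset.cons_swap]
  simpa [swapNames] using this

theorem Proves.bind {x : ℕ} (h : Proves cl D ((0, A) ::ₘ Γ.shift) C) (hx : x ∉ Γ.dom) :
    Proves cl (D.rename (bindName x)) ((x, A) ::ₘ Γ) C := by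
  have : Set.InjOn (bindName x) (Ctx.dom ((0, A) ::ₘ Γ.shift)) := by
    rintro a ha b hb hab
    simp only [Ctx.dom_cons, Ctx.dom_shift, Set.mem_union, Set.mem_singleton_iff, Set.mem_image]
      at ha hb
    rcases ha with rfl | ⟨a, ha, rfl⟩ <;> rcases hb with rfl | ⟨b, hb, rfl⟩ <;>
      simp_all [bindName]
  simpa [bindName] using h.rename this

end names

/-! ### Substitution in types -/

namespace Ty

theorem upr_comp (ρ τ : ℕ → ℕ) : upr ρ ∘ upr τ = upr (ρ ∘ τ) := by
  ext n; cases n <;> rfl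

theorem rename_rename (A : Ty) (ρ τ : ℕ → ℕ) : (A.rename τ).rename ρ = A.rename (ρ ∘ τ) := by
  induction A generalizing ρ τ <;> simp_all [rename, upr_comp]

theorem up_comp_upr (σ : ℕ → Ty) (ρ : ℕ → ℕ) : up σ ∘ upr ρ = up (σ ∘ ρ) := by
  funext n; cases n <;> rfl

theorem rename_subst (A : Ty) (σ : ℕ → Ty) (ρ : ℕ → ℕ) :
    (A.rename ρ).subst σ = A.subst (σ ∘ ρ) := by
  induction A generalizing σ ρ <;> simp_all [rename, subst, up_comp_upr]

theorem rename_upr_comp_up (σ : ℕ → Ty) (ρ : ℕ → ℕ) :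
    (fun n => (up σ n).rename (upr ρ)) = up fun n => (σ n).rename ρ := by
  funext n
  cases n with
  | zero => rfl
  | succ n => simp only [up, rename_rename]; rfl

theorem subst_rename (A : Ty) (σ : ℕ → Ty) (ρ : ℕ → ℕ) :
    (A.subst σ).rename ρ = A.subst fun n => (σ n).rename ρ := by
  induction A generalizing σ ρ <;> simp_all [rename, subst, rename_upr_comp_up]

theorem rename_succ_subst_up (A : Ty) (σ : ℕ → Ty) :
    (A.rename Nat.succ).subst (up σ) = (A.subst σ).rename Nat.succ := by
  rw [rename_subst, subst_rename]; rfl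

theorem subst_up_comp_up (σ τ : ℕ → Ty) :
    (fun n => (up σ n).subst (up τ)) = up fun n => (σ n).subst τ := by
  funext n
  cases n with
  | zero => rfl
  | succ n => exact rename_succ_subst_up _ _

theorem subst_subst (A : Ty) (σ τ : ℕ → Ty) :
    (A.subst σ).subst τ = A.subst fun n => (σ n).subst τ := by
  induction A generalizing σ τ <;> simp_all [subst, subst_up_comp_up]

theorem subst_eq_self {A : Ty} {σ : ℕ → Ty} (h : ∀ n ∈ A.fv, σ n = var n) : A.subst σ = A := by
  induction A generalizing σ with
  | var n => exact h n rfl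
  | lolli A B ihA ihB | amp A B ihA ihB =>
    simp only [subst]
    rw [ihA fun n hn => h n (.inl hn), ihB fun n hn => h n (.inr hn)]
  | all A ih =>
    simp only [subst]
    rw [ih]
    rintro (_ | n) hn
    · rfl
    · simp only [up, h n hn, rename]

theorem Closed.subst {A : Ty} (h : A.Closed) (σ : ℕ → Ty) : A.subst σ = A :=
  subst_eq_self fun n hn => by rw [h] at hn; exact hn.elim

theorem subst_var (A : Ty) : A.subst var = A := subst_eq_self fun _ _ => rfl

theorem rename_eq_subst (A : Ty) (ρ : ℕ → ℕ) : A.rename ρ = A.subst fun n => var (ρ n) := by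
  rw [← subst_var (A.rename ρ), rename_subst]; rfl

theorem inst_subst (A B : Ty) (σ : ℕ → Ty) :
    (A.inst B).subst σ = (A.subst (up σ)).inst (B.subst σ) := by
  rw [inst, inst, subst_subst, subst_subst]
  congr 1
  funext n
  cases n with
  | zero => rfl
  | succ n =>
    simp only [up, rename_subst]
    exact (subst_var _).symm

theorem rename_succ_inst (A B : Ty) : (A.rename Nat.succ).subst (single B) = A := by
  rw [rename_subst]; exact subst_var A

theorem fv_rename (A : Ty) (ρ : ℕ → ℕ) : (A.rename ρ).fv = ρ '' A.fv := by
  induction A generalizing ρ with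
  | var n => simp [rename, fv]
  | lolli A B ihA ihB | amp A B ihA ihB => simp [rename, fv, ihA, ihB, Set.image_union]
  | all A ih =>
    ext n
    simp only [rename, fv, ih]
    constructor
    · rintro ⟨_ | m, hm, e⟩
      · cases e
      · exact ⟨m, hm, Nat.succ.inj e⟩
    · rintro ⟨m, hm, rfl⟩; exact ⟨m + 1, hm, rfl⟩

/-! ### Lazy types -/

/-- No positive (`p = false`) resp. negative (`p = true`) subtype is of the form `∀α.B`. -/
def NoAll : Bool → Ty → Prop
  | _, var _ => True
  | p, lolli A B => A.NoAll (!p) ∧ B.NoAll p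
  | p, amp A B => A.NoAll p ∧ B.NoAll p
  | p, all A => p = true ∧ A.NoAll p

/-- `Subtype` extends a path downwards from the fixed type `A`, so the induction is on the type `B`
reached so far. -/
theorem exists_subtype_all {p : Bool} {A B : Ty} (h : Subtype p B A) (hB : ¬ B.NoAll p) :
    ∃ B', Subtype false (all B') A := by
  induction B generalizing p with
  | var n => exact (hB trivial).elim
  | lolli B C ihB ihC =>
    rcases not_and_or.1 hB with hB | hB
    · exact ihB h.lolli_left hB
    · exact ihC h.lolli_right hB
  | amp B C ihB ihC =>
    rcases not_and_or.1 hB with hB | hB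
    · exact ihB h.amp_left hB
    · exact ihC h.amp_right hB
  | all B ih =>
    rcases not_and_or.1 hB with hB | hB
    · rw [Bool.not_eq_true] at hB
      subst hB; exact ⟨_, h⟩
    · exact ih h.all_body hB

theorem ForallLazy.noAll {A : Ty} (h : A.ForallLazy) : A.NoAll true := by
  by_contra h'
  exact h (exists_subtype_all (.refl A) h')

theorem noAll_rename {p : Bool} {A : Ty} {ρ : ℕ → ℕ} : (A.rename ρ).NoAll p ↔ A.NoAll p := by
  induction A generalizing p ρ with
  | var n => rfl
  | lolli A B ihA ihB | amp A B ihA ihB => exact and_congr ihA ihB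
  | all A ih => exact and_congr_right fun _ => ih

/-- The path that always takes the right component keeps its positive sign, so it meets no `∀` and
ends at a free variable. -/
theorem NoAll.fv_ne_empty {A : Ty} (h : A.NoAll false) : A.fv ≠ ∅ := by
  induction A with
  | var n => simp [fv]
  | lolli A B _ ih | amp A B _ ih => simp [fv, ih h.2]
  | all A => cases h.1

/-- Twice the number of connectives plus the number of occurrences of variables. -/
def weight : Ty → ℕ
  | var _ => 1
  | lolli A B => A.weight + B.weight + 2
  | amp A B => A.weight + B.weight + 2
  | all A => A.weight + 2

theorem weight_pos (A : Ty) : 1 ≤ A.weight := by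
  cases A <;> simp [weight]

theorem weight_rename (A : Ty) (ρ : ℕ → ℕ) : (A.rename ρ).weight = A.weight := by
  induction A generalizing ρ <;> simp_all [rename, weight]

end Ty

namespace Ctx

/-- Assumptions stand to the left of `⊸` in the type of the judgement, hence the flipped sign. -/
def NoAll (Γ : Ctx) : Prop := ∀ p ∈ Γ, p.2.NoAll false

@[simp] theorem noAll_add {Γ Δ : Ctx} : (Γ + Δ).NoAll ↔ Γ.NoAll ∧ Δ.NoAll := by
  simp only [NoAll, Multiset.mem_add, or_imp, forall_and]

@[simp] theorem noAll_cons {Γ : Ctx} {x : ℕ} {A : Ty} :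
    NoAll ((x, A) ::ₘ Γ) ↔ A.NoAll false ∧ Γ.NoAll := by
  simp only [NoAll, Multiset.mem_cons, or_imp, forall_and, forall_eq]

@[simp] theorem noAll_singleton {x : ℕ} {A : Ty} : NoAll {(x, A)} ↔ A.NoAll false := by
  simp [NoAll]

@[simp] theorem noAll_zero : NoAll 0 := by simp [NoAll]

@[simp] theorem noAll_shift {Γ : Ctx} : Γ.shift.NoAll ↔ Γ.NoAll := by
  simp only [NoAll, shift, Multiset.mem_map, forall_exists_index, and_imp,
    forall_apply_eq_imp_iff₂]

@[simp] theorem noAll_tshift {Γ : Ctx} : Γ.tshift.NoAll ↔ Γ.NoAll := by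
  simp only [NoAll, tshift, Multiset.mem_map, forall_exists_index, and_imp,
    forall_apply_eq_imp_iff₂, Ty.noAll_rename]

def weight (Γ : Ctx) : ℕ := (Γ.map fun p => p.2.weight).sum

@[simp] theorem weight_zero : weight 0 = 0 := rfl
@[simp] theorem weight_add (Γ Δ : Ctx) : (Γ + Δ).weight = Γ.weight + Δ.weight := by
  simp [weight]
@[simp] theorem weight_cons (x : ℕ) (A : Ty) (Γ : Ctx) :
    weight ((x, A) ::ₘ Γ) = A.weight + Γ.weight := by simp [weight]
@[simp] theorem weight_singleton (x : ℕ) (A : Ty) : weight {(x, A)} = A.weight := by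
  simp [weight]
@[simp] theorem weight_shift (Γ : Ctx) : Γ.shift.weight = Γ.weight := by
  simp [weight, shift]
@[simp] theorem weight_tshift (Γ : Ctx) : Γ.tshift.weight = Γ.weight := by
  simp [weight, tshift, Ty.weight_rename]

end Ctx

theorem noAll_of_foldr {l : List Ty} {B : Ty} (h : (l.foldr Ty.lolli B).NoAll true) :
    (∀ A ∈ l, A.NoAll false) ∧ B.NoAll true := by
  induction l with
  | nil => exact ⟨by simp, h⟩
  | cons A l ih => exact ⟨by simpa using ⟨h.1, (ih h.2).1⟩, (ih h.2).2⟩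

theorem ForallLazyJudgement.noAll {Γ : Ctx} {B : Ty} (h : ForallLazyJudgement Γ B) :
    Γ.NoAll ∧ B.NoAll true := by
  obtain ⟨h₁, h₂⟩ := noAll_of_foldr (h _ (Multiset.coe_toList (Γ.map Prod.snd))).noAll
  refine ⟨fun p hp => h₁ _ ?_, h₂⟩
  exact Multiset.mem_toList.2 (Multiset.mem_map_of_mem _ hp)

/-! ### Cut-free lazy derivations -/

/-- The derivability relation of the fragment to which cut-free lazy derivations belong. -/
inductive LazyProves : Drv → Ctx → Ty → Prop
  | ax (x : ℕ) (A : Ty) : LazyProves (.ax x A) {(x, A)} A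
  | lolR {D : Drv} {Γ : Ctx} {A B : Ty} :
      LazyProves D ((0, A) ::ₘ Γ.shift) B → LazyProves (.lolR D) Γ (.lolli A B)
  | lolL {y : ℕ} {D E : Drv} {Γ Δ : Ctx} {A B C : Ty} :
      LazyProves D Γ A → LazyProves E ((0, B) ::ₘ Δ.shift) C → B.NoAll false →
      Disjoint Γ.dom Δ.dom → y ∉ Γ.dom → y ∉ Δ.dom →
      LazyProves (.lolL y D E) ((y, .lolli A B) ::ₘ (Γ + Δ)) C
  | ampR0 {D E : Drv} {A₁ A₂ : Ty} : LazyProves D 0 A₁ → LazyProves E 0 A₂ →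
      A₁.Closed → A₁.ForallLazy → A₂.Closed → A₂.ForallLazy →
      LazyProves (.ampR0 D E) 0 (.amp A₁ A₂)
  | allR {D : Drv} {Γ : Ctx} {A : Ty} :
      LazyProves D Γ.tshift A → LazyProves (.allR D) Γ (.all A)

/-- Without cuts, laziness passes from conclusion to premises. The missing left rules are
impossible: `∀L` exhibits a positive `∀` in the context, while `&Li` and `&R1` put a closed type
there. -/
theorem Proves.lazyProves {cl : Prop} {D : Drv} {Γ : Ctx} {A : Ty} (h : Proves cl D Γ A)
    (hc : D.CutFree) (hΓ : Γ.NoAll) (hA : A.NoAll true) : LazyProves D Γ A := by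
  induction D generalizing Γ A with
  | ax x A =>
    obtain ⟨rfl, rfl⟩ := proves_ax.1 h
    exact .ax _ _
  | cut D E => exact (hc (.inl trivial)).elim
  | lolR D ih =>
    obtain ⟨A, B, h₁, rfl⟩ := proves_lolR.1 h
    exact .lolR (ih h₁ hc (by simpa [hΓ] using hA.1) hA.2)
  | lolL y D E ihD ihE =>
    obtain ⟨Γ₁, Δ, A, B, h₁, h₂, h₃, h₄, h₅, h₆, rfl⟩ := proves_lolL.1 h
    simp only [Ctx.noAll_cons, Ctx.noAll_add] at hΓ
    obtain ⟨hT, hΓ₁, hΔ⟩ := hΓ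
    simp only [Drv.CutFree, Drv.HasCut, not_or] at hc
    exact .lolL (ihD h₁ hc.1 hΓ₁ hT.1) (ihE h₂ hc.2 (by simp [hT.2, hΔ]) hA) hT.2 h₃ h₄ h₅
  | ampR0 D E ihD ihE =>
    obtain ⟨A₁, A₂, h₁, h₂, a, b, c, d, rfl, rfl⟩ := proves_ampR0.1 h
    simp only [Drv.CutFree, Drv.HasCut, not_or] at hc
    exact .ampR0 (ihD h₁ hc.1 (by simp) hA.1) (ihE h₂ hc.2 (by simp) hA.2) a b c d
  | ampL i y A₁ A₂ D ih =>
    obtain ⟨Δ, h₁, h₂, a, b, c, d, rfl⟩ := proves_ampL.1 h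
    rw [Ctx.noAll_cons] at hΓ
    exact (hΓ.1.1.fv_ne_empty a).elim
  | ampR1 x D₁ D₂ D₃ =>
    obtain ⟨A, A₁, A₂, h₁, h₂, h₃, a, b, c, rfl, rfl⟩ := proves_ampR1.1 h
    rw [Ctx.noAll_singleton] at hΓ
    exact (hΓ.fv_ne_empty a.1).elim
  | allR D ih =>
    obtain ⟨A, h₁, h₂, rfl⟩ := proves_allR.1 h
    exact .allR (ih h₁ hc (by simpa using hΓ) hA.2)
  | allL y A B D ih =>
    obtain ⟨Δ, h₁, h₂, rfl⟩ := proves_allL.1 h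
    rw [Ctx.noAll_cons] at hΓ
    cases hΓ.1.1

namespace LazyProves

variable {D : Drv} {Γ : Ctx} {A : Ty}

/-- A set of type variables that does not split any assumption and misses the conclusion misses
all assumptions. -/
theorem disjoint_fv (h : LazyProves D Γ A) {S : Set ℕ}
    (hΓ : ∀ p ∈ Γ, p.2.fv ⊆ S ∨ Disjoint p.2.fv S) (hA : Disjoint A.fv S) :
    ∀ p ∈ Γ, Disjoint p.2.fv S := by
  have shift : ∀ {Q : Ty → Prop} {B : Ty} {Δ : Ctx},
      (∀ p ∈ (0, B) ::ₘ Ctx.shift Δ, Q p.2) ↔ Q B ∧ ∀ p ∈ Δ, Q p.2 := by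
    intro Q B Δ
    simp only [Ctx.shift, Multiset.mem_cons, Multiset.mem_map, or_imp, forall_and, forall_eq,
      forall_exists_index, and_imp, forall_apply_eq_imp_iff₂]
  induction h generalizing S with
  | ax x A => simpa using hA
  | @lolR D Γ A B h ih =>
    simp only [Ty.fv, Set.disjoint_union_left] at hA
    have := ih (shift (Q := fun T => T.fv ⊆ S ∨ Disjoint T.fv S).2 ⟨.inr hA.1, hΓ⟩) hA.2
    exact (shift (Q := fun T => Disjoint T.fv S).1 this).2
  | @lolL y D E Γ Δ A B C _ _ hB _ _ _ ihD ihE =>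
    simp only [Multiset.mem_cons, Multiset.mem_add, forall_eq, or_imp, forall_and,
      Ty.fv, Set.disjoint_union_left, Set.union_subset_iff] at hΓ ⊢
    obtain ⟨hT, hΓ, hΔ⟩ := hΓ
    have hB' : B.fv ⊆ S ∨ Disjoint B.fv S := hT.imp And.right And.right
    have hE := (shift (Q := fun T => Disjoint T.fv S).1
      (ihE (shift (Q := fun T => T.fv ⊆ S ∨ Disjoint T.fv S).2 ⟨hB', hΔ⟩) hA))
    -- If the main formula lay inside `S`, then `B` would be both inside and outside `S`, hence
    -- closed, against `hB`.
    rcases hT with hT | hT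
    · exact (hB.fv_ne_empty (disjoint_self.1 (hE.1.mono_right hT.2))).elim
    · exact ⟨hT, ihD hΓ hT.1, hE.2⟩
  | ampR0 => simp
  | @allR D Γ A _ ih =>
    -- The shifted set omits the bound variable `0`, which may be free in the body but in no shifted
    -- assumption. This case is why the statement is about arbitrary `S`.
    have := ih (S := Nat.succ '' S) (by
      simp only [Ctx.tshift, Multiset.mem_map, forall_exists_index, and_imp]
      rintro _ p hp rfl
      simp only [Ty.fv_rename]
      exact (hΓ p hp).imp (Set.image_mono ·)
        (Set.disjoint_image_iff Nat.succ_injective).2) (by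
      rw [Set.disjoint_left] at hA ⊢
      rintro _ ha ⟨n, hn, rfl⟩
      exact hA ha hn)
    intro p hp
    have := this _ (Multiset.mem_map_of_mem _ hp)
    rwa [Ty.fv_rename, Set.disjoint_image_iff Nat.succ_injective] at this

/-- This is the closure condition of `∀R`, obtained from the set of all variables. -/
theorem fv_eq_empty_of_closed (h : LazyProves D Γ A) (hA : A.Closed) : Γ.fv = ∅ := by
  have := h.disjoint_fv (S := Set.univ) (by simp) (by rw [hA]; simp)
  simp only [Set.disjoint_univ] at this
  ext n
  simp only [Ctx.fv, Set.mem_ofPred_eq, Set.mem_empty_iff_false, iff_false, not_exists, not_and]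
  intro p hp
  simp [this p hp]

/-- Assumptions would have to be closed, which lazy ones never are. This is what makes critical cuts
ready. -/
theorem eq_zero_of_closed (h : LazyProves D Γ A) (hΓ : Γ.NoAll) (hA : A.Closed) : Γ = 0 := by
  refine Multiset.eq_zero_of_forall_notMem fun p hp => (hΓ p hp).fv_ne_empty ?_
  have := h.fv_eq_empty_of_closed hA
  by_contra h'
  obtain ⟨n, hn⟩ := Set.nonempty_iff_ne_empty.2 h'
  have : n ∈ Γ.fv := ⟨p, hp, hn⟩
  simp_all

/-- Every logical rule of the fragment adds exactly one connective, of weight 2, to the formulas of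
its premises, and an axiom contains at least two variable occurrences or connectives. -/
theorem two_mul_size_le (h : LazyProves D Γ A) : 2 * D.size ≤ Γ.weight + A.weight := by
  induction h with
  | ax x A => have := A.weight_pos; simp [Drv.size]; omega
  | _ => simp_all [Drv.size, Ty.weight]; try omega

/-- Slack arises only at axioms, and an atomic one has weight exactly 2. -/
theorem two_mul_size_eq (h : LazyProves D Γ A) (hD : D.AtomicAxioms) :
    2 * D.size = Γ.weight + A.weight := by
  induction h with
  | ax x A => obtain ⟨n, rfl⟩ := hD; simp [Drv.size, Ty.weight]
  | lolL _ _ _ _ _ _ ihD ihE =>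
    have := ihD hD.1
    have := ihE hD.2
    simp_all [Drv.size, Ty.weight]; omega
  | ampR0 _ _ _ _ _ _ ihD ihE =>
    have := ihD hD.1
    have := ihE hD.2
    simp_all [Drv.size, Ty.weight]; omega
  | lolR _ ih | allR _ ih =>
    have := ih hD
    simp_all [Drv.size, Ty.weight]; omega

/-- With neither cut nor `∀L`, the formulas in the tree come from the final judgement, so nothing
else can change. -/
theorem tsubst_eq_self (h : LazyProves D Γ A) {σ : ℕ → Ty} (hΓ : ∀ p ∈ Γ, p.2.subst σ = p.2)
    (hA : A.subst σ = A) : D.tsubst σ = D := by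
  have shift : ∀ {Q : Ty → Prop} {B : Ty} {Δ : Ctx}, Q B → (∀ p ∈ Δ, Q p.2) →
      (∀ p ∈ (0, B) ::ₘ Ctx.shift Δ, Q p.2) := by
    intro Q B Δ h₁ h₂
    simp only [Ctx.shift, Multiset.mem_cons, Multiset.mem_map, or_imp, forall_and, forall_eq,
      forall_exists_index, and_imp, forall_apply_eq_imp_iff₂]
    exact ⟨h₁, h₂⟩
  induction h generalizing σ with
  | ax x A => simp [Drv.tsubst, hA]
  | lolR _ ih =>
    simp only [Ty.subst, Ty.lolli.injEq] at hA
    rw [Drv.tsubst, ih (shift (Q := fun T => T.subst σ = T) hA.1 hΓ) hA.2]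
  | lolL _ _ _ _ _ _ ihD ihE =>
    simp only [Multiset.mem_cons, Multiset.mem_add, forall_eq, or_imp, forall_and,
      Ty.subst, Ty.lolli.injEq] at hΓ
    rw [Drv.tsubst, ihD hΓ.2.1 hΓ.1.1,
      ihE (shift (Q := fun T => T.subst σ = T) hΓ.1.2 hΓ.2.2) hA]
  | ampR0 _ _ _ _ _ _ ihD ihE =>
    simp only [Ty.subst, Ty.amp.injEq] at hA
    rw [Drv.tsubst, ihD (by simp) hA.1, ihE (by simp) hA.2]
  | allR _ ih =>
    simp only [Ty.subst, Ty.all.injEq] at hA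
    rw [Drv.tsubst, ih _ hA]
    simp only [Ctx.tshift, Multiset.mem_map, forall_exists_index, and_imp]
    rintro _ p hp rfl
    rw [Ty.rename_succ_subst_up, hΓ p hp]

/-- The condition on `⊸L` is vacuous, since `B` has a free variable; the condition on `∀R` is
`fv_eq_empty_of_closed`. -/
theorem proves (h : LazyProves D Γ A) : Proves True D Γ A := by
  induction h with
  | ax x A => exact proves_ax.2 ⟨rfl, rfl⟩
  | lolR _ ih => exact proves_lolR.2 ⟨_, _, ih, rfl⟩
  | lolL _ _ hB a b c ihD ihE =>
    exact proves_lolL.2 ⟨_, _, _, _, ihD, ihE, a, b, c, fun _ h => (hB.fv_ne_empty h).elim, rfl⟩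
  | ampR0 _ _ a b c d ihD ihE => exact proves_ampR0.2 ⟨_, _, ihD, ihE, a, b, c, d, rfl, rfl⟩
  | allR h ih =>
    exact proves_allR.2 ⟨_, ih, fun _ hA => (LazyProves.allR h).fv_eq_empty_of_closed hA, rfl⟩

end LazyProves

/-! ### Substitution of types in derivations -/

/-- The closure conditions are dropped because they are not stable: a substitution may close `B` and
not `A`. -/
theorem Proves.tsubst {D : Drv} {Γ : Ctx} {A : Ty} (h : Proves False D Γ A) (σ : ℕ → Ty) :
    Proves False (D.tsubst σ) (Γ.tsub σ) (A.subst σ) := by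
  induction D generalizing Γ A σ with
  | ax x A =>
    obtain ⟨rfl, rfl⟩ := proves_ax.1 h
    exact proves_ax.2 ⟨by simp, rfl⟩
  | cut D E ihD ihE =>
    obtain ⟨Γ₁, Δ, B, h₁, h₂, h₃, rfl⟩ := proves_cut.1 h
    exact proves_cut.2 ⟨_, _, _, ihD h₁ σ, by simpa using ihE h₂ σ, by simpa using h₃, by simp⟩
  | lolR D ih =>
    obtain ⟨A, B, h₁, rfl⟩ := proves_lolR.1 h
    exact proves_lolR.2 ⟨_, _, by simpa using ih h₁ σ, rfl⟩
  | lolL y D E ihD ihE =>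
    obtain ⟨Γ₁, Δ, A, B, h₁, h₂, h₃, h₄, h₅, h₆, rfl⟩ := proves_lolL.1 h
    exact proves_lolL.2 ⟨_, _, _, _, ihD h₁ σ, by simpa using ihE h₂ σ, by simpa using h₃,
      by simpa using h₄, by simpa using h₅, fun h => h.elim, by simp [Ty.subst]⟩
  | ampR0 D E ihD ihE =>
    obtain ⟨A₁, A₂, h₁, h₂, a, b, c, d, rfl, rfl⟩ := proves_ampR0.1 h
    exact proves_ampR0.2 ⟨A₁, A₂, by simpa [a.subst] using ihD h₁ σ,
      by simpa [c.subst] using ihE h₂ σ, a, b, c, d, rfl, by simp [Ty.subst, a.subst, c.subst]⟩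
  | ampL i y A₁ A₂ D ih =>
    obtain ⟨Δ, h₁, h₂, a, b, c, d, rfl⟩ := proves_ampL.1 h
    have hi : (i.pick A₁ A₂).subst σ = i.pick A₁ A₂ := by
      cases i
      · exact a.subst σ
      · exact c.subst σ
    rw [Drv.tsubst, a.subst, c.subst]
    exact proves_ampL.2 ⟨_, by simpa [hi] using ih h₁ σ, by simpa using h₂, a, b, c, d,
      by simp [Ty.subst, a.subst, c.subst]⟩
  | ampR1 x D₁ D₂ D₃ ih₁ ih₂ =>
    obtain ⟨A, A₁, A₂, h₁, h₂, ⟨V, h₃, hV⟩, a, b, c, rfl, rfl⟩ := proves_ampR1.1 h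
    -- The value condition concerns the term derived by `D₃`, so this premise must be literally
    -- unchanged and not merely provable.
    have h₃' : D₃.tsubst σ = D₃ :=
      (Proves.lazyProves ⟨V, h₃⟩ c.1 (by simp) a.2.noAll).tsubst_eq_self (by simp) (a.1.subst σ)
    rw [Drv.tsubst, h₃']
    exact proves_ampR1.2 ⟨A, A₁, A₂, by simpa [a.1.subst, b.1.subst] using ih₁ h₁ σ,
      by simpa [a.1.subst, b.2.2.1.subst] using ih₂ h₂ σ, ⟨V, h₃, hV⟩, a, b, c,
      by simp [a.1.subst], by simp [Ty.subst, b.1.subst, b.2.2.1.subst]⟩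
  | allR D ih =>
    obtain ⟨A, h₁, h₂, rfl⟩ := proves_allR.1 h
    refine proves_allR.2 ⟨_, ?_, fun h => h.elim, rfl⟩
    have := ih h₁ (Ty.up σ)
    simp only [Ctx.tsub, Ctx.tshift, Multiset.map_map, Function.comp_def,
      Ty.rename_succ_subst_up] at this ⊢
    exact this
  | allL y A B D ih =>
    obtain ⟨Δ, h₁, h₂, rfl⟩ := proves_allL.1 h
    exact proves_allL.2 ⟨_, by simpa [Ty.inst_subst] using ih h₁ σ, by simpa using h₂,
      by simp [Ty.subst]⟩

theorem Proves.tshift {D : Drv} {Γ : Ctx} {A : Ty} (h : Proves False D Γ A) :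
    Proves False D.tshift Γ.tshift (A.rename Nat.succ) := by
  simpa [Drv.tshift, Ctx.tsub, Ctx.tshift, Ty.rename_eq_subst] using h.tsubst fun n => .var (n + 1)

theorem Proves.inst {D : Drv} {Γ : Ctx} {A : Ty} (h : Proves False D Γ.tshift A) (B : Ty) :
    Proves False (D.tsubst (Ty.single B)) Γ (A.inst B) := by
  have := h.tsubst (Ty.single B)
  simpa [Ty.inst, Ctx.tsub, Ctx.tshift, Ty.rename_succ_inst] using this

/-! ### Cut-elimination steps preserve provability -/

theorem ReadyRule.proves {D D' : Drv} (hr : ReadyRule D D') {Γ : Ctx} {C : Ty}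
    (h : Proves False D Γ C) : Proves False D' Γ C := by
  obtain ⟨D, D₁, D₂, D₃, hd, hc⟩ := hr
  obtain ⟨Γ₁, Δ, A, h₁, h₂, h₃, rfl⟩ := proves_cut.1 h
  obtain ⟨A', A₁, A₂, k₁, k₂, k₃, a, b, c, e, rfl⟩ := proves_ampR1.1 h₂
  obtain ⟨rfl, hz⟩ := Ctx.cons_zero_shift_eq_cons_zero (e.trans (Multiset.cons_zero _).symm)
  have hΔ : Δ = 0 := Ctx.shift_injective (by simpa using hz.symm)
  subst hΔ
  have hΓ : Γ₁ = 0 := Ctx.eq_zero_of_dom_eq_empty (h₁.dom_eq ▸ hd)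
  subst hΓ
  refine proves_ampR0.2 ⟨A₁, A₂, ?_, ?_, b.1, b.2.1, b.2.2.1, b.2.2.2, rfl, rfl⟩ <;>
  exact proves_cut.2 ⟨0, 0, A, h₁, by assumption, by simp, rfl⟩

theorem SymmetricRule.proves {D D' : Drv} (hr : SymmetricRule D D') {Γ : Ctx} {C : Ty}
    (h : Proves False D Γ C) : Proves False D' Γ C := by
  cases hr with
  | ax_right D A =>
    obtain ⟨Γ₁, Δ, A, h₁, h₂, h₃, rfl⟩ := proves_cut.1 h
    obtain ⟨e, rfl⟩ := proves_ax.1 h₂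
    obtain ⟨rfl, hz⟩ := Ctx.cons_zero_shift_eq_cons_zero (e.trans (Multiset.cons_zero _).symm)
    have hΔ : Δ = 0 := Ctx.shift_injective (by simpa using hz.symm)
    subst hΔ
    simpa using h₁
  | ax_left x A E =>
    obtain ⟨Γ₁, Δ, A, h₁, h₂, h₃, rfl⟩ := proves_cut.1 h
    obtain ⟨rfl, rfl⟩ := proves_ax.1 h₁
    rw [Multiset.singleton_add]
    exact h₂.bind (by simpa using h₃)
  | lolli D P Q =>
    obtain ⟨Γ₁, Δ, A, h₁, h₂, h₃, rfl⟩ := proves_cut.1 h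
    obtain ⟨A, B, k, rfl⟩ := proves_lolR.1 h₁
    obtain ⟨Γ₂, Δ₂, A', B', l₁, l₂, l₃, l₄, l₅, l₆, e⟩ := proves_lolL.1 h₂
    obtain ⟨e', hz⟩ := Ctx.cons_zero_shift_eq_cons_zero e
    cases e'
    obtain ⟨Γ₂, Δ₂, rfl, rfl, rfl⟩ := Ctx.shift_eq_add hz.symm
    simp only [Ctx.dom_add, Set.disjoint_union_right, Ctx.dom_shift,
      Set.disjoint_image_iff Nat.succ_injective] at h₃ l₃
    refine proves_cut.2 ⟨Γ₂ + Γ₁, Δ₂, B, proves_cut.2 ⟨Γ₂, Γ₁, A, l₁.unshift, k, h₃.1.symm, rfl⟩,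
      l₂.unshift_one, by simp [h₃, l₃], ?_⟩
    rw [← add_assoc, add_comm Γ₁]
  | amp D₁ D₂ i A₁ A₂ Q =>
    obtain ⟨Γ₁, Δ, A, h₁, h₂, h₃, rfl⟩ := proves_cut.1 h
    obtain ⟨A₁, A₂, k₁, k₂, a, b, c, d, rfl, rfl⟩ := proves_ampR0.1 h₁
    obtain ⟨Δ', l₁, l₂, a', b', c', d', e⟩ := proves_ampL.1 h₂
    obtain ⟨e', rfl⟩ := Ctx.cons_zero_shift_eq_cons_zero e
    cases e'
    refine proves_cut.2 ⟨0, Δ, i.pick A₁ A₂, ?_, l₁.unshift_one, h₃, rfl⟩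
    cases i
    · exact k₁
    · exact k₂
  | all D A B Q =>
    obtain ⟨Γ₁, Δ, A, h₁, h₂, h₃, rfl⟩ := proves_cut.1 h
    obtain ⟨A, k, -, rfl⟩ := proves_allR.1 h₁
    obtain ⟨Δ', l₁, l₂, e⟩ := proves_allL.1 h₂
    obtain ⟨e', rfl⟩ := Ctx.cons_zero_shift_eq_cons_zero e
    cases e'
    exact proves_cut.2 ⟨Γ₁, Δ, _, k.inst B, l₁.unshift_one, h₃, rfl⟩

/-- Cut above a rule of the right premise with an active assumption. -/
theorem Proves.cut_swap {L Q : Drv} {Γ Δ : Ctx} {A B C : Ty} (hL : Proves False L Γ A)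
    (hQ : Proves False Q ((0, B) ::ₘ Ctx.shift ((0, A) ::ₘ Δ.shift)) C)
    (hd : Disjoint Γ.dom Δ.dom) :
    Proves False (.cut (L.rename Nat.succ) (Q.rename swapNames)) ((0, B) ::ₘ Ctx.shift (Γ + Δ)) C := by
  rw [Ctx.shift_cons] at hQ
  refine proves_cut.2 ⟨Γ.shift, (0, B) ::ₘ Δ.shift, A, hL.shift, by simpa using hQ.swap, ?_, ?_⟩
  · simpa [Set.disjoint_image_iff Nat.succ_injective] using hd
  · simp

/-- Cut above a left rule of the left premise. -/
theorem Proves.cut_left {Q R : Drv} {Γ Δ : Ctx} {A B C : Ty}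
    (hQ : Proves False Q ((0, B) ::ₘ Γ.shift) A) (hR : Proves False R ((0, A) ::ₘ Δ.shift) C)
    (hd : Disjoint Γ.dom Δ.dom) :
    Proves False (.cut Q (R.rename (Ty.upr Nat.succ))) ((0, B) ::ₘ Ctx.shift (Γ + Δ)) C := by
  refine proves_cut.2 ⟨(0, B) ::ₘ Γ.shift, Δ.shift, A, hQ, hR.shift_one, ?_, by simp⟩
  simpa [Set.disjoint_image_iff Nat.succ_injective] using hd

theorem PermutationRule.proves {D D' : Drv} (hr : PermutationRule D D') {Γ : Ctx} {C : Ty}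
    (h : Proves False D Γ C) : Proves False D' Γ C := by
  cases hr with
  | right_cut_left L P Q h0 =>
    obtain ⟨Γ₁, Δ, A, h₁, h₂, h₃, rfl⟩ := proves_cut.1 h
    obtain ⟨Γ₂, Δ₂, B, k₁, k₂, k₃, e⟩ := proves_cut.1 h₂
    rw [k₁.dom_eq] at h0
    obtain ⟨X, Y, rfl, rfl, rfl⟩ := Ctx.cons_zero_shift_eq_add_left e h0
    simp only [Ctx.dom_add, Set.disjoint_union_right, Ctx.dom_shift, Ctx.dom_cons,
      Set.disjoint_union_left, Set.disjoint_image_iff Nat.succ_injective] at h₃ k₃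
    refine proves_cut.2 ⟨Γ₁ + X, Y, B, proves_cut.2 ⟨Γ₁, X, A, h₁, k₁, h₃.1, rfl⟩,
      k₂.unshift_one, by simp [h₃, k₃], by rw [add_assoc]⟩
  | right_cut_right L P Q h0 =>
    obtain ⟨Γ₁, Δ, A, h₁, h₂, h₃, rfl⟩ := proves_cut.1 h
    obtain ⟨Γ₂, Δ₂, B, k₁, k₂, k₃, e⟩ := proves_cut.1 h₂
    have h0' : 0 ∈ Δ₂.dom := by
      rw [k₂.dom_eq] at h0
      simpa using h0
    obtain ⟨X, Y, rfl, rfl, rfl⟩ := Ctx.cons_zero_shift_eq_add_right e h0'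
    simp only [Ctx.dom_add, Set.disjoint_union_right, Ctx.dom_shift, Ctx.dom_cons,
      Set.disjoint_image_iff Nat.succ_injective] at h₃ k₃
    refine proves_cut.2 ⟨X, Γ₁ + Y, B, k₁.unshift, h₁.cut_swap k₂ h₃.2,
      by simp [h₃.1.symm, k₃], add_left_comm _ _ _⟩
  | right_lolR L Q =>
    obtain ⟨Γ₁, Δ, A, h₁, h₂, h₃, rfl⟩ := proves_cut.1 h
    obtain ⟨B, C, k, rfl⟩ := proves_lolR.1 h₂
    exact proves_lolR.2 ⟨B, C, h₁.cut_swap k h₃, rfl⟩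
  | right_lolL_left L y P Q h0 =>
    obtain ⟨Γ₁, Δ, A, h₁, h₂, h₃, rfl⟩ := proves_cut.1 h
    obtain ⟨Γ₂, Δ₂, B, B', k₁, k₂, k₃, k₄, k₅, k₆, e⟩ := proves_lolL.1 h₂
    obtain ⟨Z, e', rfl⟩ := Ctx.cons_zero_shift_eq_cons_succ e
    rw [k₁.dom_eq] at h0
    obtain ⟨X, Y, rfl, rfl, rfl⟩ := Ctx.cons_zero_shift_eq_add_left e'.symm h0
    simp only [Ctx.dom_add, Set.disjoint_union_right, Ctx.dom_shift, Ctx.dom_cons,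
      Set.disjoint_union_left, Set.disjoint_image_iff Nat.succ_injective,
      Set.disjoint_singleton_right] at h₃ k₃
    refine proves_lolL.2 ⟨Γ₁ + X, Y, B, B', proves_cut.2 ⟨Γ₁, X, A, h₁, k₁, h₃.2.1, rfl⟩,
      k₂.unshift_one, by simp [h₃, k₃], ?_, by simpa using k₅, fun h => h.elim, ?_⟩
    · simpa [h₃] using k₄
    · rw [Multiset.add_cons, add_assoc]
  | right_lolL_right L y P Q h0 =>
    obtain ⟨Γ₁, Δ, A, h₁, h₂, h₃, rfl⟩ := proves_cut.1 h
    obtain ⟨Γ₂, Δ₂, B, B', k₁, k₂, k₃, k₄, k₅, k₆, e⟩ := proves_lolL.1 h₂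
    obtain ⟨Z, e', rfl⟩ := Ctx.cons_zero_shift_eq_cons_succ e
    have h0' : 0 ∈ Δ₂.dom := by
      rw [k₂.dom_eq] at h0
      simpa using h0
    obtain ⟨X, Y, rfl, rfl, rfl⟩ := Ctx.cons_zero_shift_eq_add_right e'.symm h0'
    simp only [Ctx.dom_add, Set.disjoint_union_right, Ctx.dom_shift, Ctx.dom_cons,
      Set.disjoint_image_iff Nat.succ_injective,
      Set.disjoint_singleton_right] at h₃ k₃
    refine proves_lolL.2 ⟨X, Γ₁ + Y, B, B', k₁.unshift, h₁.cut_swap k₂ h₃.2.2,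
      by simp [h₃.2.1.symm, k₃], by simpa using k₄, ?_, fun h => h.elim, ?_⟩
    · simpa [h₃] using k₅
    · rw [Multiset.add_cons, add_left_comm]
  | right_ampL L i y A₁ A₂ Q =>
    obtain ⟨Γ₁, Δ, A, h₁, h₂, h₃, rfl⟩ := proves_cut.1 h
    obtain ⟨Δ', l₁, l₂, a, b, c, d, e⟩ := proves_ampL.1 h₂
    obtain ⟨Z, rfl, rfl⟩ := Ctx.cons_zero_shift_eq_cons_succ e
    simp only [Set.disjoint_union_right, Ctx.dom_cons, Set.disjoint_singleton_right] at h₃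
    refine proves_ampL.2 ⟨Γ₁ + Z, h₁.cut_swap l₁ h₃.2, ?_, a, b, c, d, Multiset.add_cons _ _ _⟩
    simpa [h₃] using l₂
  | right_allR L Q =>
    obtain ⟨Γ₁, Δ, A, h₁, h₂, h₃, rfl⟩ := proves_cut.1 h
    obtain ⟨C, k, -, rfl⟩ := proves_allR.1 h₂
    refine proves_allR.2 ⟨C, proves_cut.2 ⟨Γ₁.tshift, Δ.tshift, _, h₁.tshift, ?_,
      by simpa using h₃, by simp⟩, fun h => h.elim, rfl⟩
    rw [Ctx.shift_tshift, ← Ctx.tshift_cons]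
    exact k
  | right_allL L y A B Q =>
    obtain ⟨Γ₁, Δ, A, h₁, h₂, h₃, rfl⟩ := proves_cut.1 h
    obtain ⟨Δ', l₁, l₂, e⟩ := proves_allL.1 h₂
    obtain ⟨Z, rfl, rfl⟩ := Ctx.cons_zero_shift_eq_cons_succ e
    simp only [Set.disjoint_union_right, Ctx.dom_cons, Set.disjoint_singleton_right] at h₃
    refine proves_allL.2 ⟨Γ₁ + Z, h₁.cut_swap l₁ h₃.2, ?_, Multiset.add_cons _ _ _⟩
    simpa [h₃] using l₂
  | left_cut P Q R =>
    obtain ⟨Γ₁, Δ, A, h₁, h₂, h₃, rfl⟩ := proves_cut.1 h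
    obtain ⟨Γ₂, Δ₂, B, k₁, k₂, k₃, rfl⟩ := proves_cut.1 h₁
    simp only [Ctx.dom_add, Set.disjoint_union_left] at h₃
    exact proves_cut.2 ⟨Γ₂, Δ₂ + Δ, B, k₁, k₂.cut_left h₂ h₃.2, by simp [h₃, k₃], add_assoc _ _ _⟩
  | left_lolL y P Q R =>
    obtain ⟨Γ₁, Δ, A, h₁, h₂, h₃, rfl⟩ := proves_cut.1 h
    obtain ⟨Γ₂, Δ₂, B, B', k₁, k₂, k₃, k₄, k₅, k₆, rfl⟩ := proves_lolL.1 h₁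
    simp only [Ctx.dom_add, Ctx.dom_cons, Set.disjoint_union_left,
      Set.disjoint_singleton_left] at h₃
    exact proves_lolL.2 ⟨Γ₂, Δ₂ + Δ, B, B', k₁, k₂.cut_left h₂ h₃.2.2, by simp [h₃, k₃], k₄,
      by simp [h₃, k₅], fun h => h.elim, by rw [Multiset.cons_add, add_assoc]⟩
  | left_ampL i y A₁ A₂ Q R =>
    obtain ⟨Γ₁, Δ, A, h₁, h₂, h₃, rfl⟩ := proves_cut.1 h
    obtain ⟨Δ', l₁, l₂, a, b, c, d, rfl⟩ := proves_ampL.1 h₁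
    simp only [Ctx.dom_cons, Set.disjoint_union_left, Set.disjoint_singleton_left] at h₃
    exact proves_ampL.2 ⟨Δ' + Δ, l₁.cut_left h₂ h₃.2, by simp [h₃, l₂], a, b, c, d,
      Multiset.cons_add _ _ _⟩
  | left_allL y A B Q R =>
    obtain ⟨Γ₁, Δ, A, h₁, h₂, h₃, rfl⟩ := proves_cut.1 h
    obtain ⟨Δ', l₁, l₂, rfl⟩ := proves_allL.1 h₁
    simp only [Ctx.dom_cons, Set.disjoint_union_left, Set.disjoint_singleton_left] at h₃
    exact proves_allL.2 ⟨Δ' + Δ, l₁.cut_left h₂ h₃.2, by simp [h₃, l₂], Multiset.cons_add _ _ _⟩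

theorem CommutingRule.proves {D D' : Drv} (hr : CommutingRule D D') {Γ : Ctx} {C : Ty}
    (h : Proves False D Γ C) : Proves False D' Γ C := by
  cases hr with
  | mk _ hp => exact hp.proves h

theorem InContext.proves {rule : Drv → Drv → Prop}
    (hrule : ∀ {D D' : Drv}, rule D D' → ∀ {Γ : Ctx} {C : Ty},
      Proves False D Γ C → Proves False D' Γ C)
    {D D' : Drv} (hr : InContext rule D D') {Γ : Ctx} {C : Ty} (h : Proves False D Γ C) :
    Proves False D' Γ C := by
  induction hr generalizing Γ C with
  | root h' => exact hrule h' h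
  | cut_left E _ ih =>
    obtain ⟨Γ₁, Δ, A, h₁, h₂, h₃, rfl⟩ := proves_cut.1 h
    exact proves_cut.2 ⟨Γ₁, Δ, A, ih h₁, h₂, h₃, rfl⟩
  | cut_right D _ ih =>
    obtain ⟨Γ₁, Δ, A, h₁, h₂, h₃, rfl⟩ := proves_cut.1 h
    exact proves_cut.2 ⟨Γ₁, Δ, A, h₁, ih h₂, h₃, rfl⟩
  | lolR _ ih =>
    obtain ⟨A, B, h₁, rfl⟩ := proves_lolR.1 h
    exact proves_lolR.2 ⟨A, B, ih h₁, rfl⟩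
  | lolL_left y E _ ih =>
    obtain ⟨Γ₁, Δ, A, B, h₁, h₂, hs⟩ := proves_lolL.1 h
    exact proves_lolL.2 ⟨Γ₁, Δ, A, B, ih h₁, h₂, hs⟩
  | lolL_right y D _ ih =>
    obtain ⟨Γ₁, Δ, A, B, h₁, h₂, hs⟩ := proves_lolL.1 h
    exact proves_lolL.2 ⟨Γ₁, Δ, A, B, h₁, ih h₂, hs⟩
  | ampR0_left E _ ih =>
    obtain ⟨A₁, A₂, h₁, h₂, hs⟩ := proves_ampR0.1 h
    exact proves_ampR0.2 ⟨A₁, A₂, ih h₁, h₂, hs⟩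
  | ampR0_right E _ ih =>
    obtain ⟨A₁, A₂, h₁, h₂, hs⟩ := proves_ampR0.1 h
    exact proves_ampR0.2 ⟨A₁, A₂, h₁, ih h₂, hs⟩
  | ampL i y A₁ A₂ _ ih =>
    obtain ⟨Δ, h₁, hs⟩ := proves_ampL.1 h
    exact proves_ampL.2 ⟨Δ, ih h₁, hs⟩
  | ampR1_left x D₂ D₃ _ ih =>
    obtain ⟨A, A₁, A₂, h₁, h₂, hs⟩ := proves_ampR1.1 h
    exact proves_ampR1.2 ⟨A, A₁, A₂, ih h₁, h₂, hs⟩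
  | ampR1_right x D₁ D₃ _ ih =>
    obtain ⟨A, A₁, A₂, h₁, h₂, hs⟩ := proves_ampR1.1 h
    exact proves_ampR1.2 ⟨A, A₁, A₂, h₁, ih h₂, hs⟩
  | allR _ ih =>
    obtain ⟨A, h₁, hs⟩ := proves_allR.1 h
    exact proves_allR.2 ⟨A, ih h₁, hs⟩
  | allL y A B _ ih =>
    obtain ⟨Δ, h₁, hs⟩ := proves_allL.1 h
    exact proves_allL.2 ⟨Δ, ih h₁, hs⟩

theorem Step.proves {D D' : Drv} (hs : Step D D') {Γ : Ctx} {C : Ty} (h : Proves False D Γ C) :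
    Proves False D' Γ C := by
  rcases hs with hs | hs | hs
  · exact InContext.proves CommutingRule.proves hs h
  · exact InContext.proves SymmetricRule.proves hs h
  · exact InContext.proves ReadyRule.proves hs h

theorem CommutingSteps.proves {k : ℕ} {D D' : Drv} (hs : CommutingSteps k D D') {Γ : Ctx}
    {C : Ty} (h : Proves False D Γ C) : Proves False D' Γ C := by
  induction hs with
  | refl D => exact h
  | step hs _ ih => exact ih (Step.proves (.inl hs) h)

/-! ### Measures -/

namespace Drv

/-- The number of cuts. -/
def cuts : Drv → ℕ
  | ax _ _ => 0
  | cut D E => D.cuts + E.cuts + 1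
  | lolR D => D.cuts
  | lolL _ D E => D.cuts + E.cuts
  | ampR0 D E => D.cuts + E.cuts
  | ampL _ _ _ _ D => D.cuts
  | ampR1 _ D₁ D₂ D₃ => D₁.cuts + D₂.cuts + D₃.cuts
  | allR D => D.cuts
  | allL _ _ _ D => D.cuts

/-- The number of logical rules. -/
def rules : Drv → ℕ
  | ax _ _ => 0
  | cut D E => D.rules + E.rules
  | lolR D => D.rules + 1
  | lolL _ D E => D.rules + E.rules + 1
  | ampR0 D E => D.rules + E.rules + 1
  | ampL _ _ _ _ D => D.rules + 1
  | ampR1 _ D₁ D₂ D₃ => D₁.rules + D₂.rules + D₃.rules + 1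
  | allR D => D.rules + 1
  | allL _ _ _ D => D.rules + 1

/-- The number of pairs of a cut and a logical rule above its left premise (third premises of
`&R1` excluded). -/
def pairs : Drv → ℕ
  | ax _ _ => 0
  | cut D E => D.pairs + E.pairs + D.rules
  | lolR D => D.pairs
  | lolL _ D E => D.pairs + E.pairs
  | ampR0 D E => D.pairs + E.pairs
  | ampL _ _ _ _ D => D.pairs
  | ampR1 _ D₁ D₂ _ => D₁.pairs + D₂.pairs
  | allR D => D.pairs
  | allL _ _ _ D => D.pairs

/-- The size, with every instance of `&R1` counted three times. -/
def potential : Drv → ℕ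
  | ax _ _ => 1
  | cut D E => D.potential + E.potential + 1
  | lolR D => D.potential + 1
  | lolL _ D E => D.potential + E.potential + 1
  | ampR0 D E => D.potential + E.potential + 1
  | ampL _ _ _ _ D => D.potential + 1
  | ampR1 _ D₁ D₂ D₃ => D₁.potential + D₂.potential + D₃.potential + 3
  | allR D => D.potential + 1
  | allL _ _ _ D => D.potential + 1

section invariance

variable (D : Drv) (ρ : ℕ → ℕ) (σ : ℕ → Ty)

@[simp] theorem size_rename : (D.rename ρ).size = D.size := by
  induction D generalizing ρ <;> simp_all [rename, size]
@[simp] theorem cuts_rename : (D.rename ρ).cuts = D.cuts := by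
  induction D generalizing ρ <;> simp_all [rename, cuts]
@[simp] theorem rules_rename : (D.rename ρ).rules = D.rules := by
  induction D generalizing ρ <;> simp_all [rename, rules]
@[simp] theorem pairs_rename : (D.rename ρ).pairs = D.pairs := by
  induction D generalizing ρ <;> simp_all [rename, pairs]
@[simp] theorem potential_rename : (D.rename ρ).potential = D.potential := by
  induction D generalizing ρ <;> simp_all [rename, potential]

@[simp] theorem size_tsubst : (D.tsubst σ).size = D.size := by
  induction D generalizing σ <;> simp_all [tsubst, size]
@[simp] theorem cuts_tsubst : (D.tsubst σ).cuts = D.cuts := by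
  induction D generalizing σ <;> simp_all [tsubst, cuts]
@[simp] theorem rules_tsubst : (D.tsubst σ).rules = D.rules := by
  induction D generalizing σ <;> simp_all [tsubst, rules]
@[simp] theorem pairs_tsubst : (D.tsubst σ).pairs = D.pairs := by
  induction D generalizing σ <;> simp_all [tsubst, pairs]
@[simp] theorem potential_tsubst : (D.tsubst σ).potential = D.potential := by
  induction D generalizing σ <;> simp_all [tsubst, potential]

theorem cuts_le_size : D.cuts ≤ D.size := by
  induction D <;> simp_all [cuts, size] <;> omega
theorem rules_le_size : D.rules ≤ D.size := by
  induction D <;> simp_all [rules, size] <;> omega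
theorem size_le_potential : D.size ≤ D.potential := by
  induction D <;> simp_all [potential, size] <;> omega
theorem potential_le : D.potential ≤ 3 * D.size := by
  induction D <;> simp_all [potential, size] <;> omega

theorem cutFree_iff : D.CutFree ↔ D.cuts = 0 := by
  unfold CutFree
  induction D <;> simp_all [HasCut, cuts, and_assoc]

end invariance

end Drv

/-- `D` and `D'` have the same size, number of cuts, number of logical rules, and potential. -/
def SameMeasures (D D' : Drv) : Prop :=
  D'.size = D.size ∧ D'.cuts = D.cuts ∧ D'.rules = D.rules ∧ D'.potential = D.potential

/-- A permutation rearranges rule instances, neither copying nor erasing any. -/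
theorem CommutingRule.sameMeasures {D D' : Drv} (h : CommutingRule D D') : SameMeasures D D' := by
  obtain ⟨-, h⟩ := h
  cases h <;>
    simp [SameMeasures, Drv.size, Drv.cuts, Drv.rules, Drv.potential, Drv.tshift] <;> omega

theorem CommutingStep.sameMeasures {D D' : Drv} (h : CommutingStep D D') : SameMeasures D D' := by
  induction h with
  | root h => exact h.sameMeasures
  | _ => simp_all [SameMeasures, Drv.size, Drv.cuts, Drv.rules, Drv.potential]

theorem CommutingSteps.sameMeasures {k : ℕ} {D D' : Drv} (h : CommutingSteps k D D') :
    SameMeasures D D' := by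
  induction h with
  | refl D => simp [SameMeasures]
  | step h _ ih =>
    have := CommutingStep.sameMeasures h
    simp_all [SameMeasures]

theorem CommutingSteps.trans {k l : ℕ} {D D' D'' : Drv} (h : CommutingSteps k D D')
    (h' : CommutingSteps l D' D'') : CommutingSteps (k + l) D D'' := by
  induction h with
  | refl D => simpa using h'
  | step hs _ ih =>
    rw [Nat.add_right_comm]
    exact .step hs (ih h')

theorem CommutingSteps.map {f : Drv → Drv}
    (hf : ∀ {D D' : Drv}, CommutingStep D D' → CommutingStep (f D) (f D')) {k : ℕ} {D D' : Drv}
    (h : CommutingSteps k D D') : CommutingSteps k (f D) (f D') := by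
  induction h with
  | refl D => exact .refl _
  | step hs _ ih => exact .step (hf hs) ih

/-! ### Normal forms for commuting cuts -/

namespace Drv

def IsAx : Drv → Prop
  | ax _ _ => True
  | _ => False

def IsAmpR1 : Drv → Prop
  | ampR1 _ _ _ _ => True
  | _ => False

/-- The last rule is a left rule. -/
def IsLeft : Drv → Prop
  | lolL _ _ _ => True
  | ampL _ _ _ _ _ => True
  | allL _ _ _ _ => True
  | _ => False

/-- The last rule introduces the assumption named `0`. -/
def IntroducesZero : Drv → Prop
  | ax _ _ => True
  | lolL y _ _ => y = 0
  | ampL _ y _ _ _ => y = 0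
  | ampR1 _ _ _ _ => True
  | allL y _ _ _ => y = 0
  | _ => False

/-- A cut to which the normalization below applies no permutation. -/
def Inert (L R : Drv) : Prop :=
  L.IsAx ∨ R.IntroducesZero ∧ (L.IsLeft → R.IsAx ∨ R.IsAmpR1)

/-- All cuts are inert. -/
def Normal : Drv → Prop
  | ax _ _ => True
  | cut D E => D.Normal ∧ E.Normal ∧ Inert D E
  | lolR D => D.Normal
  | lolL _ D E => D.Normal ∧ E.Normal
  | ampR0 D E => D.Normal ∧ E.Normal
  | ampL _ _ _ _ D => D.Normal
  | ampR1 _ D₁ D₂ _ => D₁.Normal ∧ D₂.Normal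
  | allR D => D.Normal
  | allL _ _ _ D => D.Normal

section invariance

variable (D : Drv) (ρ : ℕ → ℕ) (σ : ℕ → Ty)

@[simp] theorem isAx_rename : (D.rename ρ).IsAx ↔ D.IsAx := by
  cases D <;> rfl
@[simp] theorem isAmpR1_rename : (D.rename ρ).IsAmpR1 ↔ D.IsAmpR1 := by
  cases D <;> rfl
@[simp] theorem isLeft_rename : (D.rename ρ).IsLeft ↔ D.IsLeft := by
  cases D <;> rfl
@[simp] theorem introducesZero_rename : (D.rename (Ty.upr ρ)).IntroducesZero ↔ D.IntroducesZero := by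
  have : ∀ y, Ty.upr ρ y = 0 ↔ y = 0 := by rintro (_ | y) <;> simp [Ty.upr]
  cases D <;> simp [rename, IntroducesZero, this]
@[simp] theorem normal_rename : (D.rename ρ).Normal ↔ D.Normal := by
  induction D generalizing ρ <;> simp_all [rename, Normal, Inert]

@[simp] theorem isAx_tsubst : (D.tsubst σ).IsAx ↔ D.IsAx := by
  cases D <;> rfl
@[simp] theorem isAmpR1_tsubst : (D.tsubst σ).IsAmpR1 ↔ D.IsAmpR1 := by
  cases D <;> rfl
@[simp] theorem isLeft_tsubst : (D.tsubst σ).IsLeft ↔ D.IsLeft := by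
  cases D <;> rfl
@[simp] theorem introducesZero_tsubst : (D.tsubst σ).IntroducesZero ↔ D.IntroducesZero := by
  cases D <;> rfl
@[simp] theorem normal_tsubst : (D.tsubst σ).Normal ↔ D.Normal := by
  induction D generalizing σ <;> simp_all [tsubst, Normal, Inert]

end invariance

end Drv

open Drv

theorem commutingCut_of_not_introducesZero {L R : Drv} (hL : ¬ L.IsAx) (hR : ¬ R.IntroducesZero) :
    CommutingCut L R := by
  refine ⟨?_, ?_, ?_⟩ <;> rintro ⟨⟩ <;> simp_all [IsAx, IntroducesZero]

theorem commutingCut_of_isLeft {L R : Drv} (hL : L.IsLeft) (hR : ¬ (R.IsAx ∨ R.IsAmpR1)) :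
    CommutingCut L R := by
  refine ⟨?_, ?_, ?_⟩ <;> rintro ⟨⟩ <;> simp_all [IsAx, IsLeft, IsAmpR1]

theorem zero_mem_dom_of_cut {L R : Drv} {Γ : Ctx} {C : Ty} (h : Proves False (.cut L R) Γ C) :
    0 ∈ R.dom := by
  obtain ⟨_, _, _, -, h, -⟩ := proves_cut.1 h
  rw [h.dom_eq]; simp

/-- The cut climbs through the left rules at the end of `L`. Each one drops below the cut, so
`pairs` falls by at least one and pays for the step. -/
theorem exists_normal_cut_of_introducesZero {L R : Drv} {Γ : Ctx} {C : Ty} (hL : L.Normal)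
    (hR : R.Normal) (hR0 : R.IntroducesZero) (h : Proves False (.cut L R) Γ C) :
    ∃ k N, CommutingSteps k (.cut L R) N ∧ N.Normal ∧
      k + N.pairs ≤ L.pairs + R.pairs + L.rules := by
  have base : ∀ {L R : Drv}, L.Normal → R.Normal → Inert L R → ∃ k N,
      CommutingSteps k (.cut L R) N ∧ N.Normal ∧ k + N.pairs ≤ L.pairs + R.pairs + L.rules :=
    fun hL hR hin => ⟨0, _, .refl _, ⟨hL, hR, hin⟩, by simp [pairs]⟩
  induction L generalizing R Γ C with
  | ax | cut | lolR | ampR0 | ampR1 | allR =>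
    exact base hL hR (.inr ⟨hR0, fun h => h.elim⟩)
  | lolL y P Q _ ih =>
    by_cases hin : R.IsAx ∨ R.IsAmpR1
    · exact base hL hR (.inr ⟨hR0, fun _ => hin⟩)
    have hs : CommutingStep _ _ :=
      .root (.mk (commutingCut_of_isLeft (L := .lolL y P Q) trivial hin) (.left_lolL y P Q R))
    obtain ⟨_, _, _, _, -, h', -⟩ := proves_lolL.1 (Step.proves (.inl hs) h)
    obtain ⟨k, N, hk, hN, hb⟩ := ih hL.2 (R := R.rename (Ty.upr Nat.succ)) (by simpa using hR)
      (by simpa using hR0) h'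
    exact ⟨k + 1, _, .step hs (hk.map (.lolL_right y P)), ⟨hL.1, hN⟩, by
      simp [pairs, rules] at hb ⊢; omega⟩
  | ampL i y A₁ A₂ Q ih =>
    by_cases hin : R.IsAx ∨ R.IsAmpR1
    · exact base hL hR (.inr ⟨hR0, fun _ => hin⟩)
    have hs : CommutingStep _ _ :=
      .root (.mk (commutingCut_of_isLeft (L := .ampL i y A₁ A₂ Q) trivial hin) (.left_ampL i y A₁ A₂ Q R))
    obtain ⟨_, h', -⟩ := proves_ampL.1 (Step.proves (.inl hs) h)
    obtain ⟨k, N, hk, hN, hb⟩ := ih hL (R := R.rename (Ty.upr Nat.succ)) (by simpa using hR)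
      (by simpa using hR0) h'
    exact ⟨k + 1, _, .step hs (hk.map (.ampL i y A₁ A₂)), hN, by
      simp [pairs, rules] at hb ⊢; omega⟩
  | allL y A B Q ih =>
    by_cases hin : R.IsAx ∨ R.IsAmpR1
    · exact base hL hR (.inr ⟨hR0, fun _ => hin⟩)
    have hs : CommutingStep _ _ :=
      .root (.mk (commutingCut_of_isLeft (L := .allL y A B Q) trivial hin) (.left_allL y A B Q R))
    obtain ⟨_, h', -⟩ := proves_allL.1 (Step.proves (.inl hs) h)
    obtain ⟨k, N, hk, hN, hb⟩ := ih hL (R := R.rename (Ty.upr Nat.succ)) (by simpa using hR)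
      (by simpa using hR0) h'
    exact ⟨k + 1, _, .step hs (hk.map (.allL y A B)), hN, by
      simp [pairs, rules] at hb ⊢; omega⟩

/-- The cut climbs through `R` to the rule introducing the cut formula. These steps are paid for by
`R.size`. Entering the left premise of a cut of `R` puts the rules of `L` above that cut too, at a
price of `L.rules`; hence the factor `1 + R.cuts`, where the 1 stands for the moving cut itself. -/
theorem exists_normal_cut {L R : Drv} {Γ : Ctx} {C : Ty} (hL : L.Normal) (hR : R.Normal)
    (h : Proves False (.cut L R) Γ C) :
    ∃ k N, CommutingSteps k (.cut L R) N ∧ N.Normal ∧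
      k + N.pairs ≤ L.pairs + R.pairs + L.rules * (1 + R.cuts) + R.size := by
  induction hn : R.size using Nat.strong_induction_on generalizing L R Γ C with
  | _ n ih =>
  subst hn
  by_cases hR0 : R.IntroducesZero
  · obtain ⟨k, N, hk, hN, hb⟩ := exists_normal_cut_of_introducesZero hL hR hR0 h
    exact ⟨k, N, hk, hN, hb.trans (by nlinarith)⟩
  by_cases hLax : L.IsAx
  · exact ⟨0, _, .refl _, ⟨hL, hR, .inl hLax⟩, by simp only [pairs]; nlinarith⟩
  have hcom := commutingCut_of_not_introducesZero hLax hR0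
  have h0 := zero_mem_dom_of_cut h
  cases R with
  | ax | ampR1 => exact (hR0 trivial).elim
  | ampR0 => exact h0.elim
  | lolR Q =>
    have hs : CommutingStep _ _ := .root (.mk hcom (.right_lolR L Q))
    obtain ⟨_, _, h', -⟩ := proves_lolR.1 (Step.proves (.inl hs) h)
    obtain ⟨k, N, hk, hN, hb⟩ := ih _ (by simp [size]) (by simpa using hL)
      (by simpa [Drv.Normal] using hR) h' rfl
    exact ⟨k + 1, _, .step hs (hk.map .lolR), hN, by
      simp [pairs, cuts, size] at hb ⊢; omega⟩
  | allR Q =>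
    have hs : CommutingStep _ _ := .root (.mk hcom (.right_allR L Q))
    obtain ⟨_, h', -⟩ := proves_allR.1 (Step.proves (.inl hs) h)
    obtain ⟨k, N, hk, hN, hb⟩ := ih _ (by simp [size]) (by simpa [Drv.tshift] using hL)
      (by simpa [Drv.Normal] using hR) h' rfl
    exact ⟨k + 1, _, .step hs (hk.map .allR), hN, by
      simp [pairs, cuts, size, Drv.tshift] at hb ⊢; omega⟩
  | ampL i y A₁ A₂ Q =>
    obtain _ | y := y
    · exact (hR0 rfl).elim
    have hs : CommutingStep _ _ := .root (.mk hcom (.right_ampL L i y A₁ A₂ Q))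
    obtain ⟨_, h', -⟩ := proves_ampL.1 (Step.proves (.inl hs) h)
    obtain ⟨k, N, hk, hN, hb⟩ := ih _ (by simp [size]) (by simpa using hL)
      (by simpa [Drv.Normal] using hR) h' rfl
    exact ⟨k + 1, _, .step hs (hk.map (.ampL i y A₁ A₂)), hN, by
      simp [pairs, cuts, size] at hb ⊢; omega⟩
  | allL y A B Q =>
    obtain _ | y := y
    · exact (hR0 rfl).elim
    have hs : CommutingStep _ _ := .root (.mk hcom (.right_allL L y A B Q))
    obtain ⟨_, h', -⟩ := proves_allL.1 (Step.proves (.inl hs) h)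
    obtain ⟨k, N, hk, hN, hb⟩ := ih _ (by simp [size]) (by simpa using hL)
      (by simpa [Drv.Normal] using hR) h' rfl
    exact ⟨k + 1, _, .step hs (hk.map (.allL y A B)), hN, by
      simp [pairs, cuts, size] at hb ⊢; omega⟩
  | lolL y P Q =>
    obtain _ | y := y
    · exact (hR0 rfl).elim
    by_cases hP : 0 ∈ P.dom
    · have hs : CommutingStep _ _ := .root (.mk hcom (.right_lolL_left L y P Q hP))
      obtain ⟨_, _, _, _, h', -⟩ := proves_lolL.1 (Step.proves (.inl hs) h)
      obtain ⟨k, N, hk, hN, hb⟩ := ih _ (by simp [size]) hL hR.1 h' rfl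
      refine ⟨k + 1, _, .step hs (hk.map (.lolL_left y _)), ⟨hN, by simpa using hR.2⟩, ?_⟩
      simp [pairs, cuts, size] at hb ⊢
      nlinarith
    · have hs : CommutingStep _ _ := .root (.mk hcom (.right_lolL_right L y P Q (by
        simpa [dom, hP] using h0)))
      obtain ⟨_, _, _, _, -, h', -⟩ := proves_lolL.1 (Step.proves (.inl hs) h)
      obtain ⟨k, N, hk, hN, hb⟩ := ih _ (by simp [size]) (by simpa using hL)
        (by simpa using hR.2) h' rfl
      refine ⟨k + 1, _, .step hs (hk.map (.lolL_right y _)), ⟨by simpa using hR.1, hN⟩, ?_⟩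
      simp [pairs, cuts, size] at hb ⊢
      nlinarith
  | cut P Q =>
    obtain ⟨hPn, hQn, hin⟩ := hR
    by_cases hP : 0 ∈ P.dom
    · have hs : CommutingStep _ _ := .root (.mk hcom (.right_cut_left L P Q hP))
      have h₁ := Step.proves (.inl hs) h
      obtain ⟨_, _, _, h', -⟩ := proves_cut.1 h₁
      obtain ⟨k, N, hk, hN, hb⟩ := ih _ (by simp [size]) hL hPn h' rfl
      have hk' := CommutingSteps.map (.cut_left (Q.rename (Ty.upr Nat.pred))) hk
      have hr : N.rules = L.rules + P.rules := hk.sameMeasures.2.2.1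
      have hQn' : (Q.rename (Ty.upr Nat.pred)).Normal := by simpa using hQn
      -- `N` may end with left rules inherited from `L`, so the lower cut has to be normalized anew.
      -- The induction is on the right premise alone, so the size of `N` is harmless.
      rcases hin with hax | ⟨hQ0, -⟩
      · obtain ⟨l, N', hl, hN', hb'⟩ := ih _ (by simp [size]) hN hQn' (hk'.proves h₁) rfl
        have hPr : P.rules = 0 := by
          cases P <;> simp_all [IsAx, rules]
        refine ⟨k + l + 1, N', .step hs (hk'.trans hl), hN', ?_⟩
        simp [pairs, cuts, size, hr, hPr] at hb hb' ⊢
        nlinarith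
      · obtain ⟨l, N', hl, hN', hb'⟩ := exists_normal_cut_of_introducesZero hN hQn'
          (by simpa using hQ0) (hk'.proves h₁)
        refine ⟨k + l + 1, N', .step hs (hk'.trans hl), hN', ?_⟩
        simp [pairs, cuts, size, hr] at hb hb' ⊢
        nlinarith [Nat.zero_le (L.rules * Q.cuts)]
    · have hQ : 1 ∈ Q.dom := by simpa [dom, hP] using h0
      have hs : CommutingStep _ _ := .root (.mk hcom (.right_cut_right L P Q hQ))
      have h₁ := Step.proves (.inl hs) h
      obtain ⟨_, _, _, -, h', -⟩ := proves_cut.1 h₁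
      -- With an axiom on its left the lower cut stays inert, whatever its right premise becomes.
      -- Otherwise `L` must also pass the last rule of `Q`, so that the right premise introduces the
      -- cut formula again.
      rcases em P.IsAx with hax | hax
      · obtain ⟨k, N, hk, hN, hb⟩ := ih _ (by simp [size]) (by simpa using hL)
          (by simpa using hQn) h' rfl
        have hPr : P.rules = 0 := by
          cases P <;> simp_all [IsAx, rules]
        refine ⟨k + 1, _, .step hs (hk.map (.cut_right _)),
          ⟨by simpa using hPn, hN, .inl (by simpa using hax)⟩, ?_⟩
        simp [pairs, cuts, size, hPr] at hb ⊢
        nlinarith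
      · obtain ⟨hQ0, hleft⟩ := hin.resolve_left hax
        have h1' := zero_mem_dom_of_cut h'
        have hQ0' : 0 ∈ Q.dom := by
          obtain ⟨_, _, _, -, h₂, -⟩ := proves_cut.1 h
          exact zero_mem_dom_of_cut h₂
        have hcom' : ∀ {R : Drv}, ¬ R.IntroducesZero → CommutingCut (L.rename Nat.succ) R :=
          commutingCut_of_not_introducesZero (by simpa using hLax)
        cases Q with
        | cut | lolR | ampR0 | allR => exact hQ0.elim
        -- These have a single assumption, but both names `0` and `1` occur in `Q`.
        | ax | ampR1 =>
          simp only [dom, Set.mem_singleton_iff] at hQ hQ0'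
          omega
        | lolL y P₁ Q₁ =>
          cases hQ0
          -- `P` does not end with a left rule, because the old lower cut was inert and `Q` is
          -- neither an axiom nor `&R1`.
          have hin' : ∀ D E : Drv, Inert (P.rename Nat.pred) (.lolL 0 D E) := fun D E =>
            .inr ⟨rfl, fun hl => by simp [IsAx, IsAmpR1] at hleft hl; exact absurd hl hleft⟩
          by_cases hP₁ : 0 ∈ (P₁.rename swapNames).dom
          · have hs' : CommutingStep (.cut _ (rename swapNames (.lolL 0 P₁ Q₁))) _ :=
              .root (.mk (hcom' (by exact Nat.one_ne_zero)) (.right_lolL_left _ 0 _ _ hP₁))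
            obtain ⟨_, _, _, _, h'', -⟩ := proves_lolL.1 (Step.proves (.inl hs') h')
            obtain ⟨k, N, hk, hN, hb⟩ := ih _ (by simp [size]; omega) (by simpa using hL)
              (by simpa using hQn.1) h'' rfl
            refine ⟨k + 1 + 1, _, .step hs (.step (.cut_right _ hs')
              (hk.map fun h => .cut_right _ (.lolL_left 0 _ h))),
              ⟨by simpa using hPn, ⟨hN, by simpa using hQn.2⟩, hin' _ _⟩, ?_⟩
            simp [pairs, cuts, size] at hb ⊢
            nlinarith [Nat.zero_le (L.rules * Q₁.cuts), Nat.zero_le (L.rules * P.cuts)]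
          · have hs' : CommutingStep (.cut _ (rename swapNames (.lolL 0 P₁ Q₁))) _ :=
              .root (.mk (hcom' (by exact Nat.one_ne_zero)) (.right_lolL_right _ 0 _ _ (by
                simpa [rename, dom, swapNames, hP₁] using h1')))
            obtain ⟨_, _, _, _, -, h'', -⟩ := proves_lolL.1 (Step.proves (.inl hs') h')
            obtain ⟨k, N, hk, hN, hb⟩ := ih _ (by simp [size]; omega) (by simpa using hL)
              (by simpa using hQn.2) h'' rfl
            refine ⟨k + 1 + 1, _, .step hs (.step (.cut_right _ hs')
              (hk.map fun h => .cut_right _ (.lolL_right 0 _ h))),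
              ⟨by simpa using hPn, ⟨by simpa using hQn.1, hN⟩, hin' _ _⟩, ?_⟩
            simp [pairs, cuts, size] at hb ⊢
            nlinarith [Nat.zero_le (L.rules * P₁.cuts), Nat.zero_le (L.rules * P.cuts)]
        | ampL i y A₁ A₂ Q₁ =>
          cases hQ0
          have hin' : ∀ D : Drv, Inert (P.rename Nat.pred) (.ampL i 0 A₁ A₂ D) := fun D =>
            .inr ⟨rfl, fun hl => by simp [IsAx, IsAmpR1] at hleft hl; exact absurd hl hleft⟩
          have hs' : CommutingStep (.cut _ (rename swapNames (.ampL i 0 A₁ A₂ Q₁))) _ :=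
            .root (.mk (hcom' (by exact Nat.one_ne_zero)) (.right_ampL _ i 0 A₁ A₂ _))
          obtain ⟨_, h'', -⟩ := proves_ampL.1 (Step.proves (.inl hs') h')
          obtain ⟨k, N, hk, hN, hb⟩ := ih _ (by simp [size]; omega) (by simpa using hL)
            (by simpa [Drv.Normal] using hQn) h'' rfl
          refine ⟨k + 1 + 1, _, .step hs (.step (.cut_right _ hs')
            (hk.map fun h => .cut_right _ (.ampL i 0 A₁ A₂ h))),
            ⟨by simpa using hPn, hN, hin' _⟩, ?_⟩
          simp [pairs, cuts, size] at hb ⊢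
          nlinarith [Nat.zero_le (L.rules * P.cuts)]
        | allL y A B Q₁ =>
          cases hQ0
          have hin' : ∀ D : Drv, Inert (P.rename Nat.pred) (.allL 0 A B D) := fun D =>
            .inr ⟨rfl, fun hl => by simp [IsAx, IsAmpR1] at hleft hl; exact absurd hl hleft⟩
          have hs' : CommutingStep (.cut _ (rename swapNames (.allL 0 A B Q₁))) _ :=
            .root (.mk (hcom' (by exact Nat.one_ne_zero)) (.right_allL _ 0 A B _))
          obtain ⟨_, h'', -⟩ := proves_allL.1 (Step.proves (.inl hs') h')
          obtain ⟨k, N, hk, hN, hb⟩ := ih _ (by simp [size]; omega) (by simpa using hL)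
            (by simpa [Drv.Normal] using hQn) h'' rfl
          refine ⟨k + 1 + 1, _, .step hs (.step (.cut_right _ hs')
            (hk.map fun h => .cut_right _ (.allL 0 A B h))),
            ⟨by simpa using hPn, hN, hin' _⟩, ?_⟩
          simp [pairs, cuts, size] at hb ⊢
          nlinarith [Nat.zero_le (L.rules * P.cuts)]

/-- Cuts are treated after those above them. Steps preserve `cuts`, `rules` and `size`, so the costs
can be summed in the measures of the original tree. -/
theorem exists_normal {D : Drv} {Γ : Ctx} {C : Ty} (h : Proves False D Γ C) :
    ∃ k N, CommutingSteps k D N ∧ N.Normal ∧ k + N.pairs ≤ D.cuts * (D.rules + D.size) := by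
  induction D generalizing Γ C with
  | ax x A => exact ⟨0, _, .refl _, trivial, by simp [pairs]⟩
  | cut L R ihL ihR =>
    obtain ⟨_, _, _, hL, hR, -⟩ := proves_cut.1 h
    obtain ⟨k, N, hk, hN, hb⟩ := ihL hL
    obtain ⟨k', N', hk', hN', hb'⟩ := ihR hR
    have hs := (hk.map (.cut_left R)).trans (hk'.map (.cut_right N))
    obtain ⟨l, E, hl, hE, hbE⟩ := exists_normal_cut hN hN' (hs.proves h)
    obtain ⟨-, -, hr, -⟩ := hk.sameMeasures
    obtain ⟨hs', hc', -, -⟩ := hk'.sameMeasures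
    refine ⟨_, E, hs.trans hl, hE, ?_⟩
    rw [hr, hs', hc'] at hbE
    simp only [cuts, rules, size]
    nlinarith [Nat.zero_le (L.cuts * R.rules), Nat.zero_le (R.cuts * L.rules),
      Nat.zero_le (L.cuts * R.size), Nat.zero_le (R.cuts * L.size)]
  | lolR D ih =>
    obtain ⟨_, _, h', -⟩ := proves_lolR.1 h
    obtain ⟨k, N, hk, hN, hb⟩ := ih h'
    exact ⟨k, _, hk.map .lolR, hN, by simp only [cuts, rules, size, pairs]; nlinarith⟩
  | lolL y L R ihL ihR =>
    obtain ⟨_, _, _, _, hL, hR, -⟩ := proves_lolL.1 h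
    obtain ⟨k, N, hk, hN, hb⟩ := ihL hL
    obtain ⟨k', N', hk', hN', hb'⟩ := ihR hR
    refine ⟨_, _, (hk.map (.lolL_left y R)).trans (hk'.map (.lolL_right y N)), ⟨hN, hN'⟩, ?_⟩
    simp only [cuts, rules, size, pairs]
    nlinarith [Nat.zero_le (L.cuts * R.rules), Nat.zero_le (R.cuts * L.rules),
      Nat.zero_le (L.cuts * R.size), Nat.zero_le (R.cuts * L.size)]
  | ampR0 L R ihL ihR =>
    obtain ⟨_, _, hL, hR, -⟩ := proves_ampR0.1 h
    obtain ⟨k, N, hk, hN, hb⟩ := ihL hL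
    obtain ⟨k', N', hk', hN', hb'⟩ := ihR hR
    refine ⟨_, _, (hk.map (.ampR0_left R)).trans (hk'.map (.ampR0_right N)), ⟨hN, hN'⟩, ?_⟩
    simp only [cuts, rules, size, pairs]
    nlinarith [Nat.zero_le (L.cuts * R.rules), Nat.zero_le (R.cuts * L.rules),
      Nat.zero_le (L.cuts * R.size), Nat.zero_le (R.cuts * L.size)]
  | ampL i y A₁ A₂ D ih =>
    obtain ⟨_, h', -⟩ := proves_ampL.1 h
    obtain ⟨k, N, hk, hN, hb⟩ := ih h'
    exact ⟨k, _, hk.map (.ampL i y A₁ A₂), hN, by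
      simp only [cuts, rules, size, pairs]; nlinarith⟩
  | ampR1 x L R T ihL ihR =>
    obtain ⟨_, _, _, hL, hR, -, -, -, -⟩ := proves_ampR1.1 h
    obtain ⟨k, N, hk, hN, hb⟩ := ihL hL
    obtain ⟨k', N', hk', hN', hb'⟩ := ihR hR
    refine ⟨_, _, (hk.map (.ampR1_left x R T)).trans (hk'.map (.ampR1_right x N T)),
      ⟨hN, hN'⟩, ?_⟩
    simp only [cuts, rules, size, pairs]
    have h₁ : L.cuts * (L.rules + L.size) ≤
        L.cuts * (L.rules + R.rules + T.rules + 1 + (L.size + R.size + T.size + 1)) :=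
      Nat.mul_le_mul_left _ (by omega)
    have h₂ : R.cuts * (R.rules + R.size) ≤
        R.cuts * (L.rules + R.rules + T.rules + 1 + (L.size + R.size + T.size + 1)) :=
      Nat.mul_le_mul_left _ (by omega)
    rw [add_mul, add_mul]
    omega
  | allR D ih =>
    obtain ⟨_, h', -⟩ := proves_allR.1 h
    obtain ⟨k, N, hk, hN, hb⟩ := ih h'
    exact ⟨k, _, hk.map .allR, hN, by simp only [cuts, rules, size, pairs]; nlinarith⟩
  | allL y A B D ih =>
    obtain ⟨_, h', -⟩ := proves_allL.1 h
    obtain ⟨k, N, hk, hN, hb⟩ := ih h'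
    exact ⟨k, _, hk.map (.allL y A B), hN, by
      simp only [cuts, rules, size, pairs]; nlinarith⟩

/-! ### The strategy -/

theorem HasCut.mono {P Q : Drv → Drv → Prop} (h : ∀ L R, P L R → Q L R) {D : Drv}
    (hD : D.HasCut P) : D.HasCut Q := by
  induction D with
  | ax => exact hD
  | cut D E ihD ihE => exact hD.imp (h D E) (Or.imp ihD ihE)
  | lolR D ih | ampL i y A₁ A₂ D ih | allR D ih | allL y A B D ih => exact ih hD
  | lolL y D E ihD ihE | ampR0 D E ihD ihE => exact hD.imp ihD ihE
  | ampR1 x D₁ D₂ D₃ ih₁ ih₂ ih₃ => exact hD.imp ih₁ (Or.imp ih₂ ih₃)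

theorem Drv.CutFree.not_hasCut {P : Drv → Drv → Prop} {D : Drv} (h : D.CutFree) : ¬ D.HasCut P :=
  fun h' => h (HasCut.mono (fun _ _ _ => trivial) h')

/-- A cut between a right rule and a left rule introducing the cut formula is symmetric or
copy-first. -/
theorem symmetricCut_or_copyFirstCut {L R : Drv} {Γ : Ctx} {C : Ty}
    (h : Proves False (.cut L R) Γ C) (hL : ¬ L.IsAx) (hL' : ¬ L.IsLeft) (hc : ¬ L.EndsWithCut)
    (hR0 : R.IntroducesZero) (hR : ¬ R.IsAmpR1) : SymmetricCut L R ∨ CopyFirstCut L R := by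
  obtain ⟨Γ₁, Δ, A, h₁, h₂, -, rfl⟩ := proves_cut.1 h
  cases R with
  | cut | lolR | ampR0 | allR => exact hR0.elim
  | ax x A => exact .inl (.ax_right _ _ _)
  | ampR1 => exact (hR trivial).elim
  | lolL y P Q =>
    cases hR0
    obtain ⟨_, _, B, B', -, -, -, -, -, -, e⟩ := proves_lolL.1 h₂
    obtain ⟨rfl, -⟩ := Ctx.cons_zero_shift_eq_cons_zero e
    cases L with
    | cut D E => exact (hc ⟨_, _, rfl⟩).elim
    | ax => exact (hL trivial).elim
    | lolL | ampL | allL => exact (hL' trivial).elim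
    | lolR D => exact .inl (.lolli _ _ _)
    | ampR0 D E => obtain ⟨_, _, -, -, -, -, -, -, -, e⟩ := proves_ampR0.1 h₁; cases e
    | ampR1 x D E F => obtain ⟨_, _, _, -, -, -, -, -, -, -, e⟩ := proves_ampR1.1 h₁; cases e
    | allR D => obtain ⟨_, -, -, e⟩ := proves_allR.1 h₁; cases e
  | ampL i y A₁ A₂ Q =>
    cases hR0
    obtain ⟨_, -, -, -, -, -, -, e⟩ := proves_ampL.1 h₂
    obtain ⟨rfl, -⟩ := Ctx.cons_zero_shift_eq_cons_zero e
    cases L with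
    | cut D E => exact (hc ⟨_, _, rfl⟩).elim
    | ax => exact (hL trivial).elim
    | lolL | ampL | allL => exact (hL' trivial).elim
    | lolR D => obtain ⟨_, _, -, e⟩ := proves_lolR.1 h₁; cases e
    | ampR0 D E => exact .inl (.amp _ _ _ _ _ _)
    | ampR1 x D E F => exact .inr (.mk _ _ _ _ _ _ _ _)
    | allR D => obtain ⟨_, -, -, e⟩ := proves_allR.1 h₁; cases e
  | allL y A B Q =>
    cases hR0
    obtain ⟨_, -, -, e⟩ := proves_allL.1 h₂
    obtain ⟨rfl, -⟩ := Ctx.cons_zero_shift_eq_cons_zero e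
    cases L with
    | cut D E => exact (hc ⟨_, _, rfl⟩).elim
    | ax => exact (hL trivial).elim
    | lolL | ampL | allL => exact (hL' trivial).elim
    | lolR D => obtain ⟨_, _, -, e⟩ := proves_lolR.1 h₁; cases e
    | ampR0 D E => obtain ⟨_, _, -, -, -, -, -, -, -, e⟩ := proves_ampR0.1 h₁; cases e
    | ampR1 x D E F => obtain ⟨_, _, _, -, -, -, -, -, -, -, e⟩ := proves_ampR1.1 h₁; cases e
    | allR D => exact .inl (.all _ _ _ _)

/-- In a normal derivation, a cut with a given property is provable and inert, and every rule that
applies to it yields a step of the whole derivation. -/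
theorem HasCut.exists_proves {P : Drv → Drv → Prop} {D : Drv} (hD : D.HasCut P) {Γ : Ctx} {C : Ty}
    (h : Proves False D Γ C) (hn : D.Normal) :
    ∃ L R Γ' C', P L R ∧ Proves False (.cut L R) Γ' C' ∧ Inert L R ∧
      ∀ (rule : Drv → Drv → Prop) (E : Drv), rule (.cut L R) E → ∃ D', InContext rule D D' := by
  have lift : ∀ {f : Drv → Drv} {D₀ : Drv},
      (∀ (rule : Drv → Drv → Prop) (D' : Drv), InContext rule D₀ D' →
        InContext rule (f D₀) (f D')) →
      (∃ L R Γ' C', P L R ∧ Proves False (.cut L R) Γ' C' ∧ Inert L R ∧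
        ∀ (rule : Drv → Drv → Prop) (E : Drv), rule (.cut L R) E →
          ∃ D', InContext rule D₀ D') →
      (∃ L R Γ' C', P L R ∧ Proves False (.cut L R) Γ' C' ∧ Inert L R ∧
        ∀ (rule : Drv → Drv → Prop) (E : Drv), rule (.cut L R) E →
          ∃ D', InContext rule (f D₀) D') := by
    rintro f D₀ hf ⟨L, R, Γ', C', hP, hpr, hin, hrule⟩
    refine ⟨L, R, Γ', C', hP, hpr, hin, fun rule E hE => ?_⟩
    obtain ⟨D', hD'⟩ := hrule rule E hE
    exact ⟨_, hf rule D' hD'⟩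
  induction D generalizing Γ C with
  | ax => exact hD.elim
  | cut D E ihD ihE =>
    obtain ⟨_, _, _, h₁, h₂, -⟩ := proves_cut.1 h
    rcases hD with hD | hD | hD
    · exact ⟨D, E, Γ, C, hD, h, hn.2.2, fun rule E hE => ⟨_, .root hE⟩⟩
    · exact lift (f := fun D => .cut D E) (fun _ _ => .cut_left E) (ihD hD h₁ hn.1)
    · exact lift (fun _ _ => .cut_right D) (ihE hD h₂ hn.2.1)
  | lolR D ih =>
    obtain ⟨_, _, h₁, -⟩ := proves_lolR.1 h
    exact lift (fun _ _ => .lolR) (ih hD h₁ hn)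
  | lolL y D E ihD ihE =>
    obtain ⟨_, _, _, _, h₁, h₂, -⟩ := proves_lolL.1 h
    rcases hD with hD | hD
    · exact lift (f := fun D => .lolL y D E) (fun _ _ => .lolL_left y E) (ihD hD h₁ hn.1)
    · exact lift (fun _ _ => .lolL_right y D) (ihE hD h₂ hn.2)
  | ampR0 D E ihD ihE =>
    obtain ⟨_, _, h₁, h₂, -⟩ := proves_ampR0.1 h
    rcases hD with hD | hD
    · exact lift (f := fun D => .ampR0 D E) (fun _ _ => .ampR0_left E) (ihD hD h₁ hn.1)
    · exact lift (fun _ _ => .ampR0_right D) (ihE hD h₂ hn.2)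
  | ampL i y A₁ A₂ D ih =>
    obtain ⟨_, h₁, -⟩ := proves_ampL.1 h
    exact lift (fun _ _ => .ampL i y A₁ A₂) (ih hD h₁ hn)
  | ampR1 x D₁ D₂ D₃ ih₁ ih₂ =>
    obtain ⟨_, _, _, h₁, h₂, -, -, -, hc, -⟩ := proves_ampR1.1 h
    rcases hD with hD | hD | hD
    · exact lift (f := fun D => .ampR1 x D D₂ D₃) (fun _ _ => .ampR1_left x D₂ D₃)
        (ih₁ hD h₁ hn.1)
    · exact lift (f := fun D => .ampR1 x D₁ D D₃) (fun _ _ => .ampR1_right x D₁ D₃)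
        (ih₂ hD h₂ hn.2)
    · exact (hc.1.not_hasCut hD).elim
  | allR D ih =>
    obtain ⟨_, h₁, -⟩ := proves_allR.1 h
    exact lift (fun _ _ => .allR) (ih hD h₁ hn)
  | allL y A B D ih =>
    obtain ⟨_, h₁, -⟩ := proves_allL.1 h
    exact lift (fun _ _ => .allL y A B) (ih hD h₁ hn)

/-- An inert commuting cut with no cut above its left premise would oppose a right rule to a left
rule on the same formula, hence would not be commuting. -/
theorem commutingPhaseDone_of_normal {D : Drv} {Γ : Ctx} {C : Ty} (h : Proves False D Γ C)
    (hn : D.Normal) : CommutingPhaseDone D := by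
  intro hD
  obtain ⟨L, R, Γ', C', ⟨hcom, hL, -⟩, hpr, hin, -⟩ := HasCut.exists_proves hD h hn
  obtain ⟨hs, hcf, hcr⟩ := hcom
  have hLax : ¬ L.IsAx := fun h => by
    cases L <;> first | exact hs (.ax_left _ _ _) | exact h.elim
  have hRax : ¬ R.IsAx := fun h => by
    cases R <;> first | exact hs (.ax_right _ _ _) | exact h.elim
  have hRc : ¬ R.IsAmpR1 := fun h => by
    cases R <;> first | exact hcr (.mk _ _ _ _ _) | exact h.elim
  obtain ⟨hR0, hl⟩ := hin.resolve_left hLax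
  rcases symmetricCut_or_copyFirstCut hpr hLax (fun h => (hl h).elim hRax hRc) hL hR0 hRc with h | h
  · exact hs h
  · exact hcf h

theorem exists_symmetricRule {L R : Drv} {Γ : Ctx} {C : Ty} (h : Proves False (.cut L R) Γ C)
    (hs : SymmetricCut L R) : ∃ E, SymmetricRule (.cut L R) E := by
  cases hs with
  | ax_left x A E => exact ⟨_, .ax_left x A R⟩
  | ax_right D x A =>
    have := zero_mem_dom_of_cut h
    cases this
    exact ⟨_, .ax_right L A⟩
  | lolli D P Q => exact ⟨_, .lolli D P Q⟩
  | amp D₁ D₂ i A₁ A₂ Q => exact ⟨_, .amp D₁ D₂ i A₁ A₂ Q⟩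
  | all D A B Q => exact ⟨_, .all D A B Q⟩

/-- The search keeps the context lazy and, at a cut, moves only into the left premise, whose context
is part of the present one. The conclusion need not be lazy when the last rule is a cut, as cut
formulas are arbitrary. -/
theorem exists_readyStep {D : Drv} {Γ : Ctx} {C : Ty} (h : Proves False D Γ C) (hn : D.Normal)
    (hs : ¬ D.HasCut SymmetricCut) (hΓ : Γ.NoAll)
    (hC : D.EndsWithCut ∨ C.NoAll true ∧ ¬ D.CutFree) : ∃ D', ReadyStep D D' := by
  induction D generalizing Γ C with
  | ax => rcases hC with ⟨_, _, h⟩ | ⟨-, h⟩ <;> simp_all [CutFree, HasCut]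
  | cut L R ihL ihR =>
    obtain ⟨Γ₁, Δ, A, h₁, h₂, -, rfl⟩ := proves_cut.1 h
    rw [Ctx.noAll_add] at hΓ
    simp only [HasCut, not_or] at hs
    obtain ⟨hs, hsL, hsR⟩ := hs
    have hLax : ¬ L.IsAx := fun h => by
      cases L <;> first | exact hs (.ax_left _ _ _) | exact h.elim
    have hRax : ¬ R.IsAx := fun h => by
      cases R <;> first | exact hs (.ax_right _ _ _) | exact h.elim
    obtain ⟨hR0, hl⟩ := hn.2.2.resolve_left hLax
    -- Nothing is known about the cut formula here; the first alternative of `hC` covers this case.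
    by_cases hLc : L.EndsWithCut
    · obtain ⟨D', hD'⟩ := ihL h₁ hn.1 hsL hΓ.1 (.inl hLc)
      exact ⟨_, .cut_left R hD'⟩
    by_cases hRc : R.IsAmpR1
    · cases R with
      | ampR1 x D₁ D₂ D₃ =>
        obtain ⟨A', A₁, A₂, k₁, k₂, k₃, a, b, c, e, rfl⟩ := proves_ampR1.1 h₂
        obtain ⟨rfl, -⟩ :=
          Ctx.cons_zero_shift_eq_cons_zero (e.trans (by
            have := zero_mem_dom_of_cut h
            cases this
            exact (Multiset.cons_zero _).symm))
        -- The cut formula is closed and lazy by the side conditions of `&R1`, so `L` proves a lazy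
        -- judgement: either the cut is ready, or the search continues in `L`.
        by_cases hcf : L.CutFree
        · have := (h₁.lazyProves hcf hΓ.1 a.2.noAll).eq_zero_of_closed hΓ.1 a.1
          subst this
          have hx := zero_mem_dom_of_cut h
          cases hx
          exact ⟨_, .root (.mk L D₁ D₂ D₃ (by simpa using h₁.dom_eq) hcf)⟩
        · obtain ⟨D', hD'⟩ := ihL h₁ hn.1 hsL hΓ.1 (.inr ⟨a.2.noAll, hcf⟩)
          exact ⟨_, .cut_left _ hD'⟩
      | _ => exact hRc.elim
    rcases symmetricCut_or_copyFirstCut h hLax (fun h => (hl h).elim hRax hRc) hLc hR0 hRc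
      with h | h
    · exact (hs h).elim
    · cases h with
      | mk x D₁ D₂ D₃ i A₁ A₂ Q =>
        -- A copy-first cut has a closed assumption in its left premise, which the lazy context
        -- excludes.
        obtain ⟨B, _, _, _, _, _, a, _, _, rfl, rfl⟩ := proves_ampR1.1 h₁
        exact ((Ctx.noAll_singleton.1 hΓ.1).fv_ne_empty a.1).elim
  | lolR D ih =>
    obtain ⟨A, B, h₁, rfl⟩ := proves_lolR.1 h
    obtain ⟨hC, hc⟩ := hC.resolve_left (by rintro ⟨_, _, h⟩; cases h)
    obtain ⟨D', hD'⟩ := ih h₁ hn hs (by simpa [hΓ] using hC.1) (.inr ⟨hC.2, hc⟩)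
    exact ⟨_, .lolR hD'⟩
  | lolL y D E ihD ihE =>
    obtain ⟨Γ₁, Δ, A, B, h₁, h₂, -, -, -, -, rfl⟩ := proves_lolL.1 h
    obtain ⟨hC, hc⟩ := hC.resolve_left (by rintro ⟨_, _, h⟩; cases h)
    simp only [Ctx.noAll_cons, Ctx.noAll_add] at hΓ
    obtain ⟨hT, hΓ₁, hΔ⟩ := hΓ
    simp only [HasCut, not_or] at hs
    by_cases hD : D.CutFree
    · obtain ⟨D', hD'⟩ := ihE h₂ hn.2 hs.2 (by simp [hT.2, hΔ])
        (.inr ⟨hC, fun hE => hc (not_or.2 ⟨hD, hE⟩)⟩)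
      exact ⟨_, .lolL_right y D hD'⟩
    · obtain ⟨D', hD'⟩ := ihD h₁ hn.1 hs.1 hΓ₁ (.inr ⟨hT.1, hD⟩)
      exact ⟨_, .lolL_left y E hD'⟩
  | ampR0 D E ihD ihE =>
    obtain ⟨A₁, A₂, h₁, h₂, a, b, c, d, rfl, rfl⟩ := proves_ampR0.1 h
    obtain ⟨hC, hc⟩ := hC.resolve_left (by rintro ⟨_, _, h⟩; cases h)
    simp only [HasCut, not_or] at hs
    by_cases hD : D.CutFree
    · obtain ⟨D', hD'⟩ := ihE h₂ hn.2 hs.2 (by simp)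
        (.inr ⟨hC.2, fun hE => hc (not_or.2 ⟨hD, hE⟩)⟩)
      exact ⟨_, .ampR0_right D hD'⟩
    · obtain ⟨D', hD'⟩ := ihD h₁ hn.1 hs.1 (by simp) (.inr ⟨hC.1, hD⟩)
      exact ⟨_, .ampR0_left E hD'⟩
  | ampL i y A₁ A₂ D ih =>
    obtain ⟨Δ, h₁, h₂, a, b, c, d, rfl⟩ := proves_ampL.1 h
    rw [Ctx.noAll_cons] at hΓ
    exact (hΓ.1.1.fv_ne_empty a).elim
  | ampR1 x D₁ D₂ D₃ =>
    obtain ⟨A, A₁, A₂, h₁, h₂, h₃, a, b, c, rfl, rfl⟩ := proves_ampR1.1 h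
    rw [Ctx.noAll_singleton] at hΓ
    exact (hΓ.fv_ne_empty a.1).elim
  | allR D ih =>
    obtain ⟨A, h₁, -, rfl⟩ := proves_allR.1 h
    obtain ⟨hC, hc⟩ := hC.resolve_left (by rintro ⟨_, _, h⟩; cases h)
    obtain ⟨D', hD'⟩ := ih h₁ hn hs (by simpa using hΓ) (.inr ⟨hC.2, hc⟩)
    exact ⟨_, .allR hD'⟩
  | allL y A B D ih =>
    obtain ⟨Δ, h₁, h₂, rfl⟩ := proves_allL.1 h
    rw [Ctx.noAll_cons] at hΓ
    cases hΓ.1.1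

/-! ### Decrease of the potential and the count of steps -/

theorem LazyProves.potential_eq {D : Drv} {Γ : Ctx} {A : Ty} (h : LazyProves D Γ A) :
    D.potential = D.size := by
  induction h <;> simp_all [potential, size]

/-- Both `D` and `D₃` are cut-free derivations of the same closed lazy type, so `D` is at most as
large as `D₃`, whose axioms are atomic: the second copy of `D` is paid for by `D₃`. The remaining `3
+ 1` for `&R1` and the cut exceeds the 3 for `&R0` and two cuts, which is why `&R1` counts three
times. -/
theorem ReadyRule.potential_lt {D D' : Drv} (hr : ReadyRule D D') {Γ : Ctx} {C : Ty}
    (h : Proves False D Γ C) : D'.potential < D.potential := by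
  obtain ⟨D, D₁, D₂, D₃, hd, hc⟩ := hr
  obtain ⟨Γ₁, Δ, A, h₁, h₂, -, rfl⟩ := proves_cut.1 h
  obtain ⟨A', A₁, A₂, k₁, k₂, ⟨V, k₃, -⟩, a, b, c, e, rfl⟩ := proves_ampR1.1 h₂
  obtain ⟨rfl, -⟩ := Ctx.cons_zero_shift_eq_cons_zero (e.trans (Multiset.cons_zero _).symm)
  have hΓ : Γ₁ = 0 := Ctx.eq_zero_of_dom_eq_empty (h₁.dom_eq ▸ hd)
  subst hΓ
  have hD := h₁.lazyProves hc (by simp) a.2.noAll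
  have hD₃ := Proves.lazyProves ⟨V, k₃⟩ c.1 (by simp) a.2.noAll
  have := hD.two_mul_size_le
  have := hD₃.two_mul_size_eq c.2
  have := hD.potential_eq
  have := hD₃.potential_eq
  simp only [potential]
  omega

theorem SymmetricRule.potential_lt {D D' : Drv} (hr : SymmetricRule D D') :
    D'.potential < D.potential := by
  cases hr with
  | amp D₁ D₂ i A₁ A₂ Q => cases i <;> simp [potential, Side.pick] <;> omega
  | _ => simp [potential]; try omega

theorem SymmetricStep.potential_lt {D D' : Drv} (hr : SymmetricStep D D') :
    D'.potential < D.potential := by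
  induction hr with
  | root h => exact h.potential_lt
  | _ => simp only [potential]; omega

theorem ReadyStep.potential_lt {D D' : Drv} (hr : ReadyStep D D') {Γ : Ctx} {C : Ty}
    (h : Proves False D Γ C) : D'.potential < D.potential := by
  induction hr generalizing Γ C with
  | root hr => exact hr.potential_lt h
  | cut_left E _ ih =>
    obtain ⟨_, _, _, h₁, h₂, -⟩ := proves_cut.1 h
    have := ih h₁
    simp only [potential]; omega
  | cut_right D _ ih =>
    obtain ⟨_, _, _, h₁, h₂, -⟩ := proves_cut.1 h
    have := ih h₂
    simp only [potential]; omega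
  | lolR _ ih =>
    obtain ⟨_, _, h₁, -⟩ := proves_lolR.1 h
    have := ih h₁
    simp only [potential]; omega
  | lolL_left y E _ ih =>
    obtain ⟨_, _, _, _, h₁, h₂, -⟩ := proves_lolL.1 h
    have := ih h₁
    simp only [potential]; omega
  | lolL_right y D _ ih =>
    obtain ⟨_, _, _, _, h₁, h₂, -⟩ := proves_lolL.1 h
    have := ih h₂
    simp only [potential]; omega
  | ampR0_left E _ ih =>
    obtain ⟨_, _, h₁, h₂, -⟩ := proves_ampR0.1 h
    have := ih h₁
    simp only [potential]; omega
  | ampR0_right D _ ih =>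
    obtain ⟨_, _, h₁, h₂, -⟩ := proves_ampR0.1 h
    have := ih h₂
    simp only [potential]; omega
  | ampL i y A₁ A₂ _ ih =>
    obtain ⟨_, h₁, -⟩ := proves_ampL.1 h
    have := ih h₁
    simp only [potential]; omega
  | ampR1_left x D₂ D₃ _ ih =>
    obtain ⟨_, _, _, h₁, h₂, -⟩ := proves_ampR1.1 h
    have := ih h₁
    simp only [potential]; omega
  | ampR1_right x D₁ D₃ _ ih =>
    obtain ⟨_, _, _, h₁, h₂, -⟩ := proves_ampR1.1 h
    have := ih h₂
    simp only [potential]; omega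
  | allR _ ih =>
    obtain ⟨_, h₁, -⟩ := proves_allR.1 h
    have := ih h₁
    simp only [potential]; omega
  | allL y A B _ ih =>
    obtain ⟨_, h₁, -⟩ := proves_allL.1 h
    have := ih h₁
    simp only [potential]; omega

theorem exists_secondPhase {D : Drv} {Γ : Ctx} {C : Ty} (h : Proves False D Γ C) (hn : D.Normal)
    (hΓ : Γ.NoAll) (hC : C.NoAll true) (hc : ¬ D.CutFree) :
    ∃ D', SecondPhase D D' ∧ Step D D' ∧ D'.potential < D.potential := by
  by_cases hs : D.HasCut SymmetricCut
  · obtain ⟨L, R, _, _, hLR, hpr, -, hrule⟩ := HasCut.exists_proves hs h hn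
    obtain ⟨E, hE⟩ := exists_symmetricRule hpr hLR
    obtain ⟨D', hD'⟩ := hrule _ _ hE
    exact ⟨D', .inl hD', .inr (.inl hD'), SymmetricStep.potential_lt hD'⟩
  · obtain ⟨D', hD'⟩ := exists_readyStep h hn hs hΓ (.inr ⟨hC, hc⟩)
    exact ⟨D', .inr ⟨hs, hD'⟩, .inr (.inr hD'), ReadyStep.potential_lt hD' h⟩

/-- The potential bounds the number of rounds, and twice its square bounds each commuting phase; the
`+ 1` is the second phase. -/
theorem exists_rounds {D : Drv} {Γ : Ctx} {C : Ty} (h : Proves False D Γ C) (hΓ : Γ.NoAll)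
    (hC : C.NoAll true) : ∃ n D', Rounds n D D' ∧
      n ≤ D.potential * (2 * D.potential ^ 2 + 1) ∧ D'.CutFree ∧ Proves False D' Γ C := by
  induction hm : D.potential using Nat.strong_induction_on generalizing D with
  | _ m ih =>
  subst hm
  by_cases hc : D.CutFree
  · exact ⟨0, D, .nil D, Nat.zero_le _, hc, h⟩
  obtain ⟨k, N, hk, hN, hb⟩ := exists_normal h
  have hNp := hk.proves h
  obtain ⟨-, hcuts, -, hpot⟩ := hk.sameMeasures
  obtain ⟨D₂, hsp, hst, hlt⟩ := exists_secondPhase hNp hN hΓ hC (by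
    rwa [cutFree_iff, hcuts, ← cutFree_iff])
  rw [hpot] at hlt
  obtain ⟨n, D', hr, hn, hcf, hp⟩ := ih _ hlt (hst.proves hNp) rfl
  refine ⟨k + 1 + n, D', .round hk (commutingPhaseDone_of_normal hNp hN) hsp hr, ?_, hcf, hp⟩
  have hs := D.size_le_potential
  have hk' : k ≤ 2 * D.potential ^ 2 := by
    calc k ≤ D.cuts * (D.rules + D.size) := by omega
      _ ≤ D.potential * (D.potential + D.potential) :=
        Nat.mul_le_mul (D.cuts_le_size.trans hs)
          (Nat.add_le_add (D.rules_le_size.trans hs) hs)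
      _ = 2 * D.potential ^ 2 := by ring
  calc k + 1 + n ≤ (2 * D.potential ^ 2 + 1) + D₂.potential * (2 * D.potential ^ 2 + 1) := by
        refine Nat.add_le_add (by omega) (hn.trans (Nat.mul_le_mul_left _ ?_))
        have := Nat.pow_le_pow_left hlt.le 2
        omega
    _ = (D₂.potential + 1) * (2 * D.potential ^ 2 + 1) := by ring
    _ ≤ D.potential * (2 * D.potential ^ 2 + 1) := Nat.mul_le_mul_right _ hlt

end LAM

theorem mainTheorem3 :
    ∃ c : ℕ, ∀ (D : LAM.Drv) (Γ : LAM.Ctx) (M : LAM.Term) (A : LAM.Ty),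
      LAM.IsDerivation D Γ M A → LAM.ForallLazyJudgement Γ A →
      (∀ D', Relation.ReflTransGen LAM.Step D D' → ∃ M', LAM.IsPreDerivation D' Γ M' A) ∧
      ∃ (n : ℕ) (D' : LAM.Drv) (M' : LAM.Term),
        LAM.Rounds n D D' ∧ n ≤ c * D.size ^ 3 ∧
        D'.CutFree ∧ LAM.IsDerivation D' Γ M' A := by
  -- The potential is at most `3 * D.size`, and `3 * (2 * 3 ^ 2 + 3 ^ 2) = 81`.
  refine ⟨81, fun D Γ M A hD hlazy => ?_⟩
  have h : LAM.Proves False D Γ A := ⟨M, hD.weaken⟩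
  obtain ⟨hΓ, hA⟩ := hlazy.noAll
  constructor
  · intro D' hs
    change LAM.Proves False D' Γ A
    induction hs with
    | refl => exact h
    | tail _ hs ih => exact hs.proves ih
  · obtain ⟨n, D', hr, hn, hc, hp⟩ := LAM.exists_rounds h hΓ hA
    -- Here the closure conditions come back, for the final cut-free derivation only.
    obtain ⟨M', hM'⟩ := (hp.lazyProves hc hΓ hA).proves
    refine ⟨n, D', M', hr, hn.trans ?_, hc, hM'⟩
    have h1 := D.potential_le
    have h2 : 1 ≤ D.size := by cases D <;> simp [LAM.Drv.size]
    calc D.potential * (2 * D.potential ^ 2 + 1)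
        ≤ (3 * D.size) * (2 * (3 * D.size) ^ 2 + (3 * D.size) ^ 2) := by
          refine Nat.mul_le_mul h1 (Nat.add_le_add ?_ (Nat.one_le_pow _ _ (by omega)))
          exact Nat.mul_le_mul_left _ (Nat.pow_le_pow_left h1 2)
      _ = 81 * D.size ^ 3 := by ring
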